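/- **Setting.** A metric graph $\mathcal G$ consists of a finite set of vertices, some of which are called vertices at infinity, and a finite set of edges joining them (self-loops and multiple edges are allowed), each edge $e$ being identified with an interval $I_e=[0,\ell_e]$, $0<\ell_e<\infty$, or $I_e=[0,\infty)$. The edges identified with $[0,\infty)$ (halflines) are exactly those ending at a vertex at infinity; two vertices at infinity are never joined by an edge, and each vertex at infinity has degree one. The points of $\mathcal G$ are the vertices not at infinity and the interior points of the edges. $\mathcal G$ is noncompact if it has a vertex at infinity. A trail is a path of adjacent edges in which every edge is run through exactly once. The space $H^1(\mathcal G)$ consists of the continuous functions $u:\mathcal G\to\mathbb C$ whose restriction $u_e$ to each edge belongs to $H^1(I_e)$. For $p\in(2,6)$ and $\mu>0$ put $$E(u,\mathcal G)=\frac12\sum_e\int_{I_e}|u_e'|^2\,dx-\frac1p\sum_e\int_{I_e}|u_e|^p\,dx,\qquad \mathcal E_{\mathcal G}(\mu)=\inf\Big\{E(u,\mathcal G)\;:\;u\in H^1(\mathcal G),\ \sum_e\int_{I_e}|u_e|^2\,dx=\mu\Big\},$$ and define $E(u,\mathbb R)$ and $\mathcal E_{\mathbb R}(\mu)$ in the same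 way with $H^1(\mathbb R)$. A bubble tower is a metric graph isometric to the one obtained from $\mathbb R$ by identifying $x_j$ with $-x_j$ for $j=1,\dots,n$, where $n\ge 1$ and $x_1,\dots,x_n>0$ are distinct. **Theorem (Nonexistence).** Let $\mathcal G$ be a connected noncompact metric graph satisfying Assumption (H): every point of $\mathcal G$ lies on a trail that contains two halflines. Then, for every $p\in(2,6)$ and every $\mu>0$, both infima are finite and $$\mathcal E_{\mathcal G}(\mu)=\mathcal E_{\mathbb R}(\mu).$$ The infimum $\mathcal E_{\mathcal G}(\mu)$ is never attained, except when $\mathcal G$ is isometric to the line $\mathbb R$ or is a bubble tower, in which cases it is attained. -/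

import Mathlib

open MeasureTheory
open scoped ENNReal ContDiff

noncomputable section

/-- `g` is the weak derivative of `u` in the open set `U`, tested against smooth functions
with compact support in `U`. -/
def HasWeakDerivOn (u g : ℝ → ℂ) (U : Set ℝ) : Prop :=
  ∀ φ : ℝ → ℝ, ContDiff ℝ ∞ φ → HasCompactSupport φ → tsupport φ ⊆ U →
    ∫ t in U, deriv φ t • u t = - ∫ t in U, φ t • g t

/-- `u` is (the continuous representative of) an element of the Sobolev space `H¹(I)` of the
interval `I`, and `g` is its weak derivative. -/
structure IsH1On (u g : ℝ → ℂ) (I : Set ℝ) : Prop where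
  continuousOn : ContinuousOn u I
  memLp : MemLp u 2 (volume.restrict I)
  memLp_deriv : MemLp g 2 (volume.restrict I)
  hasWeakDerivOn : HasWeakDerivOn u g (interior I)

/-- An element of `H¹(ℝ)` (continuous representative) with its weak derivative. -/
structure LineH1 where
  toFun : ℝ → ℂ
  weakDeriv : ℝ → ℂ
  isH1On : IsH1On toFun weakDeriv Set.univ

namespace LineH1

/-- `‖u‖²` in `L²(ℝ)`. -/
def mass (u : LineH1) : ℝ := ∫ t, ‖u.toFun t‖ ^ 2

/-- `E(u, ℝ) = ½ ‖u'‖₂² - (1/p) ‖u‖ₚᵖ`. -/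
def energy (u : LineH1) (p : ℝ) : ℝ :=
  1 / 2 * (∫ t, ‖u.weakDeriv t‖ ^ 2) - 1 / p * ∫ t, ‖u.toFun t‖ ^ p

end LineH1

/-- The energies of the functions of mass `μ` on the real line. -/
def lineEnergyLevels (p μ : ℝ) : Set ℝ :=
  {c | ∃ u : LineH1, u.mass = μ ∧ u.energy p = c}

/-- The infimum of the energy on the real line at mass `μ`. -/
def lineInfEnergy (p μ : ℝ) : ℝ := sInf (lineEnergyLevels p μ)

/-- A metric graph with vertex set `V` and edge set `E` (both are taken finite in use);
self-loops and multiple edges are allowed. The edge `e` is identified with `[0, len e]`, or with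
`[0, ∞)` if `len e = ∞`; coordinate `0` is `tail e` and coordinate `len e` is `head e`.
The edges of infinite length (halflines) are exactly those ending at a vertex at infinity;
they are parametrized starting from their vertex that is not at infinity, so two vertices at
infinity are never joined. Each vertex at infinity has degree one. -/
structure MetricGraph (V E : Type*) where
  tail : E → V
  head : E → V
  len : E → ℝ≥0∞
  atInf : Set V
  len_pos : ∀ e, 0 < len e
  tail_notMem_atInf : ∀ e, tail e ∉ atInf
  head_mem_atInf_iff : ∀ e, head e ∈ atInf ↔ len e = ⊤
  existsUnique_edge_atInf : ∀ v ∈ atInf, ∃! e, head e = v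

namespace MetricGraph

variable {V E : Type*} (G : MetricGraph V E)

/-- The graph is noncompact: there is a vertex at infinity. -/
def Noncompact : Prop := G.atInf.Nonempty

/-- The edge `e` is a halfline. -/
def IsHalfline (e : E) : Prop := G.len e = ⊤

/-- The starting vertex of an oriented edge: `(e, true)` is `e` run through from its tail to its
head, `(e, false)` is `e` run through in the opposite direction. -/
def source (d : E × Bool) : V := if d.2 then G.tail d.1 else G.head d.1

/-- The final vertex of an oriented edge. -/
def target (d : E × Bool) : V := if d.2 then G.head d.1 else G.tail d.1

/-- The graph is connected. -/
def Connected : Prop :=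
  Nonempty V ∧ ∀ v w : V,
    Relation.ReflTransGen (fun a b => ∃ d : E × Bool, G.source d = a ∧ G.target d = b) v w

/-- The points of the metric graph: the vertices that are not at infinity, and the interior
points of the edges. -/
def Point : Type _ :=
  {v : V // v ∉ G.atInf} ⊕ (Σ e : E, {t : ℝ // 0 < t ∧ ENNReal.ofReal t < G.len e})

/-- The interval `I_e`, i.e. `[0, len e]` or `[0, ∞)`. -/
def interval (e : E) : Set ℝ := {t | 0 ≤ t ∧ ENNReal.ofReal t ≤ G.len e}

open Classical in
/-- The point of the edge `e` at coordinate `t` (meaningful for `t` in `G.interval e`). -/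
def pt (e : E) (t : ℝ) : G.Point :=
  if h0 : t ≤ 0 then Sum.inl ⟨G.tail e, G.tail_notMem_atInf e⟩
  else if h1 : ENNReal.ofReal t < G.len e then Sum.inr ⟨e, t, lt_of_not_ge h0, h1⟩
  else Sum.inl ⟨G.head e, fun h => h1 (by
    rw [(G.head_mem_atInf_iff e).1 h]; exact ENNReal.ofReal_lt_top)⟩

/-- A trail: consecutive oriented edges are adjacent, and no edge is run through twice. -/
def IsTrail (l : List (E × Bool)) : Prop :=
  l.IsChain (fun d d' => G.target d = G.source d') ∧ (l.map Prod.fst).Nodup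

/-- The point `x` lies on one of the edges (endpoints included) of `l`. -/
def LiesOn (x : G.Point) (l : List (E × Bool)) : Prop :=
  ∃ e ∈ l.map Prod.fst, ∃ t ∈ G.interval e, G.pt e t = x

/-- Assumption (H): every point lies on a trail that contains two halflines. -/
def AssumptionH : Prop :=
  ∀ x : G.Point, ∃ l : List (E × Bool), G.IsTrail l ∧ G.LiesOn x l ∧
    ∃ e ∈ l.map Prod.fst, ∃ e' ∈ l.map Prod.fst, e ≠ e' ∧ G.IsHalfline e ∧ G.IsHalfline e'

/-- `G` is isometric to the real line with `x` and `-x` identified for each `x` in `S` (`S` is a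
finite set of positive numbers in use): there is a map `γ` of `ℝ` onto the points of `G` that
makes exactly these identifications and under which each edge is parametrized, up to a
translation and a reflection, by its own arclength coordinate. -/
def IsFoldedLine (S : Finset ℝ) : Prop :=
  ∃ γ : ℝ → G.Point, Function.Surjective γ ∧
    (∀ s t : ℝ, γ s = γ t ↔ s = t ∨ (s = -t ∧ |s| ∈ S)) ∧
    ∀ e : E, ∃ a ε : ℝ, (ε = 1 ∨ ε = -1) ∧ ∀ t ∈ G.interval e, γ (a + ε * t) = G.pt e t

/-- `G` is isometric to the real line. -/
def IsLine : Prop := G.IsFoldedLine ∅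

/-- `G` is a tower of `n ≥ 1` bubbles: up to isometry it is obtained from `ℝ` by identifying
`x₁` with `-x₁`, ..., `xₙ` with `-xₙ`, where `x₁, ..., xₙ > 0` are distinct. -/
def IsBubbleTower : Prop :=
  ∃ S : Finset ℝ, S.Nonempty ∧ (∀ x ∈ S, 0 < x) ∧ G.IsFoldedLine S

/-- An element of `H¹(G)`: a function on `G`, thus single-valued at the vertices, that is
continuous and of class `H¹` on each edge, with its weak derivative on each edge. -/
structure H1 where
  toFun : G.Point → ℂ
  weakDeriv : E → ℝ → ℂ
  isH1On : ∀ e, IsH1On (fun t => toFun (G.pt e t)) (weakDeriv e) (G.interval e)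

variable {G}
variable [Fintype E]

/-- `‖u‖²` in `L²(G)`. -/
def H1.mass (u : G.H1) : ℝ := ∑ e, ∫ t in G.interval e, ‖u.toFun (G.pt e t)‖ ^ 2

/-- `E(u, G) = ½ ‖u'‖₂² - (1/p) ‖u‖ₚᵖ`. -/
def H1.energy (u : G.H1) (p : ℝ) : ℝ :=
  1 / 2 * (∑ e, ∫ t in G.interval e, ‖u.weakDeriv e t‖ ^ 2)
    - 1 / p * ∑ e, ∫ t in G.interval e, ‖u.toFun (G.pt e t)‖ ^ p

variable (G)

/-- The energies of the functions of mass `μ` on `G`. -/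
def energyLevels (p μ : ℝ) : Set ℝ :=
  {c | ∃ u : G.H1, u.mass = μ ∧ u.energy p = c}

/-- The infimum of the energy on `G` at mass `μ`. -/
def infEnergy (p μ : ℝ) : ℝ := sInf (G.energyLevels p μ)

/-- `u` is a ground state of mass `μ`: it attains the infimum of the energy at mass `μ`. -/
def IsGroundState (p μ : ℝ) (u : G.H1) : Prop :=
  u.mass = μ ∧ u.energy p = G.infEnergy p μ

end MetricGraph

end

namespace NLSGraph

open Set Filter Topology

/-! ### Functions with a weak derivative on an interval -/

/-! The proof is a calibration argument; no rearrangement is needed. For a height M let φ be the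
even soliton with maximum M and frequency ω = (2/p) M^(p-2). On t ≥ 0 it solves φ' = -g(φ), where g
= `solSpeed p M` satisfies g(s)²/2 + s^p/p = ω s²/2 on [0, M]. If |u| ≤ M, completing the square
gives E(u) = ½ ∫ (|u'| - g(|u|))² + ∫ g(|u|) |u'| - ωμ/2 (`energy_eq_calibration`).

Take M to be the maximum of |u|. By Assumption (H) it is reached on a trail with two halflines,
which unrolls to a path γ defined on ℝ (`exists_isUnrolling`). Along γ, |u| climbs from 0 to M and
returns to 0, so the middle term is at least 2 ∫₀^M g, which is the Dirichlet integral of φ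
(`two_mul_le_integral`, `two_mul_solPrim`). Hence E(u) ≥ `solLevel p M μ`. Since the mass of a
soliton is a multiple of M^((6-p)/2), Bernoulli's inequality shows that this level is smallest
exactly at the height m whose soliton has mass μ (`solLevel_lt`), where it is the energy of that
soliton. The line is handled by the same inequality. Conversely, truncated solitons placed far out
on one halfline approach this level (`isGLB_energyLevels`).

If u attains the infimum, then M = m and |u'| = g(|u|) almost everywhere. Comparison of slopes puts
|u ∘ γ| above the soliton (`soliton_le_of_speed`); both masses being μ, they coincide and u vanishes
off the trail. As the soliton has no zeros and the graph is connected, the trail contains every edge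
(`forall_mem`). The soliton takes equal values only at ±t, so γ can identify only t with -t, and
only at finitely many vertex times: the graph is a line or a bubble tower. On such a graph the
soliton itself descends to a ground state (`exists_energy_eq`). -/

/-- A compact subset of an open interval is contained in a smaller closed interval. -/
theorem exists_Icc_of_isCompact_subset_Ioo {a b : ℝ} (hab : a < b) {K : Set ℝ} (hK : IsCompact K)
    (hKs : K ⊆ Ioo a b) : ∃ a' b', a < a' ∧ a' ≤ b' ∧ b' < b ∧ K ⊆ Icc a' b' := by
  rcases K.eq_empty_or_nonempty with rfl | hne
  · exact ⟨(a + b) / 2, (a + b) / 2, by linarith, le_rfl, by linarith, empty_subset _⟩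
  · have h1 := hKs (hK.sInf_mem hne)
    have h2 := hKs (hK.sSup_mem hne)
    refine ⟨sInf K, sSup K, h1.1, ?_, h2.2, fun x hx =>
      ⟨csInf_le hK.bddBelow hx, le_csSup hK.bddAbove hx⟩⟩
    obtain ⟨x, hx⟩ := hne
    exact (csInf_le hK.bddBelow hx).trans (le_csSup hK.bddAbove hx)

/-- The primitive from `a` vanishes to the left of the support, and to the right of it equals the
total integral, which is zero. -/
theorem exists_test_primitive {a b : ℝ} (hab : a < b) {χ : ℝ → ℝ} (hχ : ContDiff ℝ ∞ χ)
    (hc : HasCompactSupport χ) (hs : tsupport χ ⊆ Ioo a b) (h0 : ∫ t in a..b, χ t = 0) :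
    ∃ φ : ℝ → ℝ, ContDiff ℝ ∞ φ ∧ HasCompactSupport φ ∧ tsupport φ ⊆ Ioo a b ∧ deriv φ = χ := by
  obtain ⟨a', b', ha', hab', hb', hK⟩ := exists_Icc_of_isCompact_subset_Ioo hab hc hs
  have hz : ∀ t, t ∉ Icc a' b' → χ t = 0 := fun t ht => image_eq_zero_of_notMem_tsupport
    fun h => ht (hK h)
  set φ : ℝ → ℝ := fun x => ∫ t in a..x, χ t with hφ
  have hint : ∀ x y, IntervalIntegrable χ volume x y := fun x y =>
    hχ.continuous.intervalIntegrable x y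
  have hd : ∀ x, HasDerivAt φ (χ x) x := fun x =>
    intervalIntegral.integral_hasDerivAt_right (hint _ _)
      (hχ.continuous.stronglyMeasurableAtFilter _ _) hχ.continuous.continuousAt
  have hdφ : deriv φ = χ := funext fun x => (hd x).deriv
  have hout : ∀ x, x ∉ Icc a' b' → φ x = 0 := by
    intro x hx
    rcases lt_or_ge x a' with hxa | hxa
    · refine intervalIntegral.integral_zero_ae (ae_of_all _ fun t ht => hz t fun h => ?_)
      have := (mem_uIoc.1 ht)
      rcases this with h' | h' <;> linarith [h.1, h.2, h'.1, h'.2]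
    · have hxb : b' < x := by
        by_contra h; exact hx ⟨hxa, not_lt.1 h⟩
      have : φ x = (∫ t in a..b, χ t) + ∫ t in b..x, χ t :=
        (intervalIntegral.integral_add_adjacent_intervals (hint _ _) (hint _ _)).symm
      rw [this, h0, zero_add]
      refine intervalIntegral.integral_zero_ae (ae_of_all _ fun t ht => hz t fun h => ?_)
      rcases mem_uIoc.1 ht with h' | h' <;> linarith [h.1, h.2, h'.1, h'.2]
  have hts : tsupport φ ⊆ Icc a' b' := by
    refine closure_minimal (fun x hx => ?_) isClosed_Icc
    by_contra h
    exact hx (hout x h)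
  refine ⟨φ, ?_, ?_, hts.trans (fun x hx => ⟨ha'.trans_le hx.1, hx.2.trans_lt hb'⟩), hdφ⟩
  · rw [contDiff_infty_iff_deriv, hdφ]
    exact ⟨fun x => (hd x).differentiableAt, hχ⟩
  · exact HasCompactSupport.of_support_subset_isCompact isCompact_Icc
      (subset_closure.trans hts)

theorem exists_test_integral_one {a b : ℝ} (hab : a < b) :
    ∃ ρ : ℝ → ℝ, ContDiff ℝ ∞ ρ ∧ HasCompactSupport ρ ∧ tsupport ρ ⊆ Ioo a b ∧
      ∫ t in a..b, ρ t = 1 := by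
  have hmem : Ioo a b ∈ 𝓝 ((a + b) / 2) := Ioo_mem_nhds (by linarith) (by linarith)
  obtain ⟨f, hf, hc, hs, hr, h1⟩ := exists_contDiff_tsupport_subset (n := ⊤) hmem
  have hpos : 0 < ∫ t in a..b, f t := by
    rw [intervalIntegral.integral_of_le hab.le]
    have hnn : ∀ t, 0 ≤ f t := fun t => (hr ⟨t, rfl⟩).1
    have hfi : Integrable f := (hs.continuous).integrable_of_hasCompactSupport hc
    have : ∫ t in Ioc a b, f t = ∫ t, f t := by
      refine setIntegral_eq_integral_of_forall_compl_eq_zero fun x hx => ?_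
      exact image_eq_zero_of_notMem_tsupport fun h => hx (Ioo_subset_Ioc_self (hf h))
    rw [this]
    exact hs.continuous.integral_pos_of_hasCompactSupport_nonneg_nonzero hc hnn
      (x := (a + b) / 2) (by simp [h1])
  refine ⟨fun t => (∫ t in a..b, f t)⁻¹ * f t, contDiff_const.mul hs, hc.mul_left, ?_, ?_⟩
  · exact (tsupport_mul_subset_right (f := fun _ => (∫ t in a..b, f t)⁻¹)).trans hf
  · rw [intervalIntegral.integral_const_mul, inv_mul_cancel₀ hpos.ne']

/-- The lemma of du Bois-Reymond on an interval. -/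
theorem eqOn_const_of_integral_deriv_mul_eq_zero {a b : ℝ} (hab : a < b) {v : ℝ → ℝ}
    (hv : ContinuousOn v (Icc a b))
    (h : ∀ φ : ℝ → ℝ, ContDiff ℝ ∞ φ → HasCompactSupport φ → tsupport φ ⊆ Ioo a b →
      ∫ t in a..b, deriv φ t * v t = 0) : v a = v b := by
  obtain ⟨ρ, hρ, hρc, hρs, hρ1⟩ := exists_test_integral_one hab
  set c := ∫ t in a..b, ρ t * v t with hc
  have hvi : ∀ ψ : ℝ → ℝ, Continuous ψ → IntervalIntegrable (fun t => ψ t * v t) volume a b := by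
    intro ψ hψ
    apply ContinuousOn.intervalIntegrable
    rw [uIcc_of_le hab.le]
    exact hψ.continuousOn.mul hv
  have key : ∀ᵐ t, t ∈ Ioo a b → v t - c = 0 := by
    refine isOpen_Ioo.ae_eq_zero_of_integral_contDiff_smul_eq_zero ?_ ?_
    · exact ((hv.sub continuousOn_const).mono Ioo_subset_Icc_self).locallyIntegrableOn
        measurableSet_Ioo
    intro ψ hψ hψc hψs
    -- Subtracting a multiple of `ρ` makes the mean zero, so that `χ` is the derivative of a test
    -- function and the hypothesis applies to it.
    set χ : ℝ → ℝ := fun t => ψ t - (∫ t in a..b, ψ t) * ρ t with hχ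
    have hρψ : tsupport χ ⊆ tsupport ψ ∪ tsupport ρ := by
      refine closure_minimal (fun x hx => ?_)
        ((isClosed_tsupport _).union (isClosed_tsupport _))
      by_contra hcon
      rw [mem_union, not_or] at hcon
      apply hx
      simp [hχ, image_eq_zero_of_notMem_tsupport hcon.1, image_eq_zero_of_notMem_tsupport hcon.2]
    have hχ0 : ∫ t in a..b, χ t = 0 := by
      rw [hχ, intervalIntegral.integral_sub (hψ.continuous.intervalIntegrable _ _)
        ((hρ.continuous.intervalIntegrable _ _).const_mul _),
        intervalIntegral.integral_const_mul, hρ1]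
      ring
    obtain ⟨φ, hφ, hφc, hφs, hφd⟩ := exists_test_primitive hab (χ := χ)
      (hψ.sub (contDiff_const.mul hρ))
      (HasCompactSupport.of_support_subset_isCompact (hψc.isCompact.union hρc.isCompact)
        (subset_closure.trans hρψ)) (hρψ.trans (union_subset hψs hρs)) hχ0
    have h1 := h φ hφ hφc hφs
    rw [hφd] at h1
    have h2 : ∫ t in a..b, χ t * v t
        = (∫ t in a..b, ψ t * v t) - (∫ t in a..b, ψ t) * c := by
      rw [hc, ← intervalIntegral.integral_const_mul, ← intervalIntegral.integral_sub
        (hvi _ hψ.continuous) ((hvi _ hρ.continuous).const_mul _)]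
      congr 1; ext t; simp only [hχ]; ring
    have h3 : ∫ t in a..b, ψ t * (v t - c)
        = (∫ t in a..b, ψ t * v t) - (∫ t in a..b, ψ t) * c := by
      rw [← intervalIntegral.integral_mul_const, ← intervalIntegral.integral_sub
        (hvi _ hψ.continuous) ((hψ.continuous.intervalIntegrable _ _).mul_const _)]
      congr 1; ext t; ring
    rw [← h2, h1, intervalIntegral.integral_of_le hab.le] at h3
    rw [← h3]
    refine (setIntegral_eq_integral_of_forall_compl_eq_zero fun x hx => ?_).symm
    rw [image_eq_zero_of_notMem_tsupport fun h => hx (Ioo_subset_Ioc_self (hψs h)), zero_smul]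
  have hEq : EqOn v (fun _ => c) (Icc a b) := by
    have h1 : v =ᵐ[volume.restrict (Icc a b)] fun _ => c := by
      rw [← restrict_Ioo_eq_restrict_Icc, EventuallyEq, ae_restrict_iff' measurableSet_Ioo]
      filter_upwards [key] with t ht htm
      linarith [ht htm]
    exact Measure.eqOn_Icc_of_ae_eq volume hab.ne h1 hv continuousOn_const
  rw [hEq (left_mem_Icc.2 hab.le), hEq (right_mem_Icc.2 hab.le)]

/-- The primitive `W` of `g` is absolutely continuous, hence integrates by parts against test
functions; `u - W` then has zero weak derivative and equal values at the endpoints. -/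
theorem sub_eq_integral_of_weakDeriv_real {a b : ℝ} (hab : a < b) {u g : ℝ → ℝ}
    (hu : ContinuousOn u (Icc a b)) (hg : IntervalIntegrable g volume a b)
    (h : ∀ φ : ℝ → ℝ, ContDiff ℝ ∞ φ → HasCompactSupport φ → tsupport φ ⊆ Ioo a b →
      ∫ t in a..b, deriv φ t * u t = - ∫ t in a..b, φ t * g t) :
    u b - u a = ∫ t in a..b, g t := by
  set W : ℝ → ℝ := fun x => ∫ t in a..x, g t with hW
  have hWac : AbsolutelyContinuousOnInterval W a b :=
    hg.absolutelyContinuousOnInterval_intervalIntegral left_mem_uIcc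
  have hWc : ContinuousOn W (Icc a b) := by
    have := hWac.continuousOn
    rwa [uIcc_of_le hab.le] at this
  have key := eqOn_const_of_integral_deriv_mul_eq_zero hab (hu.sub hWc) ?_
  · simp only [Pi.sub_apply, hW, intervalIntegral.integral_same] at key
    linarith
  intro φ hφ hφc hφs
  have hφac : AbsolutelyContinuousOnInterval φ a b :=
    ((hφ.of_le (by simp)).contDiffOn (n := 1)).absolutelyContinuousOnInterval
  have hφa : φ a = 0 := image_eq_zero_of_notMem_tsupport fun h => lt_irrefl a (hφs h).1
  have hφb : φ b = 0 := image_eq_zero_of_notMem_tsupport fun h => lt_irrefl b (hφs h).2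
  have hip := hφac.integral_mul_deriv_eq_deriv_mul hWac
  have hdW : ∫ t in a..b, φ t * deriv W t = ∫ t in a..b, φ t * g t := by
    refine intervalIntegral.integral_congr_ae ?_
    filter_upwards [hg.ae_hasDerivAt_integral] with x hx hxm
    rw [(hx (uIoc_subset_uIcc hxm) a left_mem_uIcc).deriv]
  have hφ' : Continuous (deriv φ) := (hφ.continuous_deriv (by simp))
  have hi : ∀ f : ℝ → ℝ, ContinuousOn f (Icc a b) →
      IntervalIntegrable (fun t => deriv φ t * f t) volume a b := by
    intro f hf
    apply ContinuousOn.intervalIntegrable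
    rw [uIcc_of_le hab.le]
    exact hφ'.continuousOn.mul hf
  have := h φ hφ hφc hφs
  simp only [Pi.sub_apply, mul_sub]
  rw [intervalIntegral.integral_sub (hi _ hu) (hi _ hWc), this]
  rw [hdW, hφa, hφb] at hip
  linarith

theorem sub_eq_integral_of_weakDeriv {a b : ℝ} (hab : a < b) {u g : ℝ → ℂ}
    (hu : ContinuousOn u (Icc a b)) (hg : IntervalIntegrable g volume a b)
    (h : ∀ φ : ℝ → ℝ, ContDiff ℝ ∞ φ → HasCompactSupport φ → tsupport φ ⊆ Ioo a b →
      ∫ t in a..b, deriv φ t • u t = - ∫ t in a..b, φ t • g t) :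
    u b - u a = ∫ t in a..b, g t := by
  -- The real case applies after any real-linear functional; real and imaginary parts then suffice.
  have main : ∀ L : ℂ →L[ℝ] ℝ, L (u b - u a) = L (∫ t in a..b, g t) := by
    intro L
    rw [map_sub, ← L.intervalIntegral_comp_comm hg]
    refine sub_eq_integral_of_weakDeriv_real hab (u := fun t => L (u t)) (g := fun t => L (g t))
      (L.continuous.comp_continuousOn hu) ?_ ?_
    · exact ⟨L.integrable_comp hg.1, L.integrable_comp hg.2⟩
    intro φ hφ hφc hφs
    have hφ' : Continuous (deriv φ) := (hφ.continuous_deriv (by simp))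
    have e1 : IntervalIntegrable (fun t => deriv φ t • u t) volume a b := by
      apply ContinuousOn.intervalIntegrable
      rw [uIcc_of_le hab.le]
      exact hφ'.continuousOn.smul hu
    have e2 : IntervalIntegrable (fun t => φ t • g t) volume a b :=
      hg.continuousOn_smul hφ.continuous.continuousOn
    have := congrArg L (h φ hφ hφc hφs)
    rw [map_neg, ← L.intervalIntegral_comp_comm e1, ← L.intervalIntegral_comp_comm e2] at this
    simpa only [map_smul, smul_eq_mul] using this
  exact Complex.ext (main Complex.reCLM) (main Complex.imCLM)

theorem _root_.IsH1On.intervalIntegrable {u g : ℝ → ℂ} {I : Set ℝ} (h : IsH1On u g I)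
    {a b : ℝ} (hI : Icc a b ⊆ I) (hab : a ≤ b) : IntervalIntegrable g volume a b := by
  rw [intervalIntegrable_iff_integrableOn_Icc_of_le hab]
  have : MemLp g 2 (volume.restrict (Icc a b)) := h.memLp_deriv.mono_measure
    (Measure.restrict_mono hI le_rfl)
  exact this.integrable (by norm_num)

/-- A function in `H¹` of an interval is the primitive of its weak derivative. -/
theorem _root_.IsH1On.sub_eq_integral {u g : ℝ → ℂ} {I : Set ℝ} (h : IsH1On u g I)
    {a b : ℝ} (hI : Icc a b ⊆ I) (hab : a ≤ b) : u b - u a = ∫ t in a..b, g t := by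
  rcases hab.eq_or_lt with rfl | hab
  · simp
  refine sub_eq_integral_of_weakDeriv hab (h.continuousOn.mono hI)
    (h.intervalIntegrable hI hab.le) fun φ hφ hφc hφs => ?_
  have hU : Ioo a b ⊆ interior I := by
    rw [← interior_Icc]; exact interior_mono hI
  have := h.hasWeakDerivOn φ hφ hφc (hφs.trans hU)
  have e : ∀ F : ℝ → ℂ, (∀ t, t ∉ tsupport φ → F t = 0) →
      ∫ t in a..b, F t = ∫ t in interior I, F t := by
    intro F hF
    rw [intervalIntegral.integral_of_le hab.le,
      setIntegral_eq_integral_of_forall_compl_eq_zero fun x hx => hF x fun h' => hx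
        (Ioo_subset_Ioc_self (hφs h')),
      setIntegral_eq_integral_of_forall_compl_eq_zero fun x hx => hF x fun h' => hx
        (hU (hφs h'))]
  rw [e, e, this]
  · intro t ht; rw [image_eq_zero_of_notMem_tsupport ht, zero_smul]
  · intro t ht
    have : t ∉ tsupport (deriv φ) := fun h' => ht (tsupport_deriv_subset h')
    rw [image_eq_zero_of_notMem_tsupport this, zero_smul]

/-- A continuous function that is differentiable outside a countable set, with locally integrable
derivative, has this derivative as a weak derivative. -/
theorem hasWeakDerivOn_of_hasDerivAt {u g : ℝ → ℂ} {s : Set ℝ} (hs : s.Countable)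
    (hu : Continuous u) (hg : LocallyIntegrable g) (hd : ∀ t, t ∉ s → HasDerivAt u (g t) t)
    (U : Set ℝ) : HasWeakDerivOn u g U := by
  intro φ hφ hφc hφs
  have hφ' : Continuous (deriv φ) := (hφ.continuous_deriv (by simp))
  rw [setIntegral_eq_integral_of_forall_compl_eq_zero fun x hx => by
      rw [image_eq_zero_of_notMem_tsupport (fun h => hx (hφs (tsupport_deriv_subset h))), zero_smul],
    setIntegral_eq_integral_of_forall_compl_eq_zero fun x hx => by
      rw [image_eq_zero_of_notMem_tsupport (fun h => hx (hφs h)), zero_smul]]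
  -- The sign of `R` is unknown; with `|R| + 1` both endpoints lie strictly outside the support and
  -- the boundary terms vanish.
  obtain ⟨R, hR⟩ := hφc.isCompact.isBounded.subset_closedBall 0
  have hz : ∀ t, t ∉ Ioc (-(|R| + 1)) (|R| + 1) → t ∉ tsupport φ := by
    intro t ht h
    have := hR h
    rw [Metric.mem_closedBall, dist_zero_right, Real.norm_eq_abs] at this
    have h2 := abs_le.1 (this.trans (le_abs_self R))
    exact ht ⟨by linarith, by linarith⟩
  have hle : -(|R| + 1) ≤ |R| + 1 := by linarith [abs_nonneg R]
  have e : ∀ F : ℝ → ℂ, (∀ t, t ∉ tsupport φ → F t = 0) →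
      ∫ t in (-(|R| + 1))..(|R| + 1), F t = ∫ t, F t := by
    intro F hF
    rw [intervalIntegral.integral_of_le hle,
      setIntegral_eq_integral_of_forall_compl_eq_zero fun x hx => hF x (hz x hx)]
  have i1 : IntervalIntegrable (fun t => deriv φ t • u t) volume (-(|R| + 1)) (|R| + 1) :=
    (hφ'.smul hu).intervalIntegrable _ _
  have hgi : IntervalIntegrable g volume (-(|R| + 1)) (|R| + 1) := by
    rw [intervalIntegrable_iff_integrableOn_Icc_of_le hle]
    exact hg.integrableOn_isCompact isCompact_Icc
  have i2 : IntervalIntegrable (fun t => φ t • g t) volume (-(|R| + 1)) (|R| + 1) :=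
    hgi.continuousOn_smul hφ.continuous.continuousOn
  rw [← e _ fun t ht => ?_, ← e _ fun t ht => ?_, eq_neg_iff_add_eq_zero,
    ← intervalIntegral.integral_add i1 i2]
  · have := integral_eq_of_hasDerivAt_off_countable (fun t => φ t • u t)
      (fun t => deriv φ t • u t + φ t • g t) (a := -(|R| + 1)) (b := |R| + 1) hs
      (hφ.continuous.smul hu).continuousOn (fun x hx => ?_) (i1.add i2)
    · rw [this, image_eq_zero_of_notMem_tsupport (hz (-(|R| + 1)) (by simp)), zero_smul, sub_zero]
      have hb : |R| + 1 ∉ tsupport φ := by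
        intro h
        have := hR h
        rw [Metric.mem_closedBall, dist_zero_right, Real.norm_eq_abs,
          abs_of_nonneg (by positivity)] at this
        linarith [le_abs_self R]
      rw [image_eq_zero_of_notMem_tsupport hb, zero_smul]
    · have h1 : HasDerivAt φ (deriv φ x) x :=
        ((hφ.differentiable (by simp)) x).hasDerivAt
      have := h1.smul (hd x hx.2)
      rwa [add_comm] at this
  · rw [image_eq_zero_of_notMem_tsupport ht, zero_smul]
  · have : t ∉ tsupport (deriv φ) := fun h' => ht (tsupport_deriv_subset h')
    rw [image_eq_zero_of_notMem_tsupport this, zero_smul]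

end NLSGraph

namespace NLSGraph

open Set Filter Topology

/-! ### Nonnegative functions on the line dominated by a square integrable slope -/

theorem AbsolutelyContinuousOnInterval.of_dist_le {f K : ℝ → ℝ} {a b C : ℝ}
    (hK : AbsolutelyContinuousOnInterval K a b)
    (h : ∀ x ∈ uIcc a b, ∀ y ∈ uIcc a b, dist (f x) (f y) ≤ C * dist (K x) (K y)) :
    AbsolutelyContinuousOnInterval f a b := by
  rw [absolutelyContinuousOnInterval_iff] at hK ⊢
  intro ε hε
  -- The denominator `|C| + 1` is positive whatever the sign of `C`, and makes the final inequality
  -- strict.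
  obtain ⟨δ, hδ, H⟩ := hK (ε / (|C| + 1)) (by positivity)
  refine ⟨δ, hδ, fun E hE hs => ?_⟩
  have h1 := H E hE hs
  calc ∑ i ∈ Finset.range E.1, dist (f (E.2 i).1) (f (E.2 i).2)
      ≤ ∑ i ∈ Finset.range E.1, |C| * dist (K (E.2 i).1) (K (E.2 i).2) := by
        refine Finset.sum_le_sum fun i hi => (h _ (hE.1 i hi).1 _ (hE.1 i hi).2).trans ?_
        gcongr
        exact le_abs_self C
    _ = |C| * ∑ i ∈ Finset.range E.1, dist (K (E.2 i).1) (K (E.2 i).2) := by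
        rw [Finset.mul_sum]
    _ ≤ |C| * (ε / (|C| + 1)) := by gcongr
    _ < (|C| + 1) * (ε / (|C| + 1)) := by gcongr; linarith
    _ = ε := by field_simp

/-- Difference quotients at `x` compare before passing to the limit. With `K` a primitive of the
slope bound, this turns the integrated bound on `w` into a pointwise bound on `w'` almost
everywhere. -/
theorem abs_deriv_le_of_abs_sub_le {w K : ℝ → ℝ} {x w' h : ℝ} (hw : HasDerivAt w w' x)
    (hK : HasDerivAt K h x) (hle : ∀ y, |w y - w x| ≤ |K y - K x|) : |w'| ≤ |h| := by
  refine le_of_tendsto_of_tendsto (hasDerivAt_iff_tendsto_slope.1 hw).abs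
    (hasDerivAt_iff_tendsto_slope.1 hK).abs (Eventually.of_forall fun y => ?_)
  simp only [slope_def_field, abs_div]
  have := hle y
  gcongr

/-- `w` and `h` are nonnegative and square integrable, and `h` dominates the slope of `w`. This
holds for `w = |u|`, `h = |u'|` with `u ∈ H¹(ℝ)`. -/
structure IsSlopePair (w h : ℝ → ℝ) : Prop where
  nonneg : ∀ t, 0 ≤ w t
  slope_nonneg : ∀ t, 0 ≤ h t
  memLp : MemLp w 2
  memLp_slope : MemLp h 2
  abs_sub_le : ∀ s t, s ≤ t → |w t - w s| ≤ ∫ x in s..t, h x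

namespace IsSlopePair

variable {w h : ℝ → ℝ}

theorem locallyIntegrable (H : IsSlopePair w h) : LocallyIntegrable h :=
  H.memLp_slope.locallyIntegrable (by norm_num)

theorem intervalIntegrable (H : IsSlopePair w h) (s t : ℝ) : IntervalIntegrable h volume s t :=
  (intervalIntegrable_iff' ).2 (H.locallyIntegrable.integrableOn_isCompact isCompact_uIcc)

theorem abs_sub_le_abs (H : IsSlopePair w h) (s t : ℝ) :
    |w t - w s| ≤ |(∫ x in (0 : ℝ)..t, h x) - ∫ x in (0 : ℝ)..s, h x| := by
  rw [intervalIntegral.integral_interval_sub_left (H.intervalIntegrable _ _)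
    (H.intervalIntegrable _ _)]
  rcases le_total s t with hst | hst
  · exact (H.abs_sub_le s t hst).trans (le_abs_self _)
  · rw [abs_sub_comm, intervalIntegral.integral_symm, abs_neg]
    exact (H.abs_sub_le t s hst).trans (le_abs_self _)

theorem continuous (H : IsSlopePair w h) : Continuous w := by
  rw [continuous_iff_continuousAt]
  intro x
  have hK : Continuous fun t => ∫ x in (0 : ℝ)..t, h x :=
    intervalIntegral.continuous_primitive (fun a b => H.intervalIntegrable a b) 0
  rw [ContinuousAt, tendsto_iff_dist_tendsto_zero]
  have h1 : Tendsto (fun y => |(∫ x in (0 : ℝ)..y, h x) - ∫ x in (0 : ℝ)..x, h x|) (𝓝 x) (𝓝 0) := by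
    have := ((hK.sub (continuous_const (y := ∫ x in (0 : ℝ)..x, h x))).abs).tendsto x
    simpa using this
  refine squeeze_zero (fun _ => dist_nonneg) (fun y => ?_) h1
  rw [Real.dist_eq]
  exact H.abs_sub_le_abs x y

/-- The chain rule as an inequality. -/
theorem abs_comp_sub_le (H : IsSlopePair w h) {Φ G : ℝ → ℝ} (hΦ : ∀ x, HasDerivAt Φ (G x) x)
    (hG : Continuous G) (hG0 : ∀ x, 0 ≤ x → 0 ≤ G x) {s t : ℝ} (hst : s ≤ t) :
    |Φ (w t) - Φ (w s)| ≤ ∫ x in s..t, G (w x) * h x := by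
  set K : ℝ → ℝ := fun t => ∫ x in (0 : ℝ)..t, h x with hK
  have hKac : AbsolutelyContinuousOnInterval K s t := by
    have h1 := (H.intervalIntegrable s t).absolutelyContinuousOnInterval_intervalIntegral
      (c := s) left_mem_uIcc
    refine AbsolutelyContinuousOnInterval.of_dist_le (C := 1) h1 fun x _ y _ => ?_
    rw [one_mul, Real.dist_eq, Real.dist_eq,
      intervalIntegral.integral_interval_sub_left (H.intervalIntegrable _ _)
        (H.intervalIntegrable _ _),
      intervalIntegral.integral_interval_sub_left (H.intervalIntegrable _ _)
        (H.intervalIntegrable _ _)]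
  have hwac : AbsolutelyContinuousOnInterval w s t :=
    AbsolutelyContinuousOnInterval.of_dist_le (C := 1) hKac fun x _ y _ => by
      rw [one_mul, Real.dist_eq, Real.dist_eq]; exact H.abs_sub_le_abs y x
  obtain ⟨M, hM⟩ := (isCompact_uIcc.image H.continuous : IsCompact (w '' uIcc s t)).bddAbove
  obtain ⟨C, hC⟩ := (isCompact_Icc (a := 0) (b := M)).exists_bound_of_continuousOn hG.continuousOn
  have hwm : ∀ x ∈ uIcc s t, w x ∈ Icc 0 M := fun x hx => ⟨H.nonneg x, hM ⟨x, hx, rfl⟩⟩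
  -- `w` inherits absolute continuity from `K`, and `Φ` is Lipschitz on the bounded range `[0, M]`
  -- of `w`, with constant a bound of `G` there.
  have hfac : AbsolutelyContinuousOnInterval (fun x => Φ (w x)) s t := by
    refine AbsolutelyContinuousOnInterval.of_dist_le (C := C) hwac fun x hx y hy => ?_
    rw [Real.dist_eq, Real.dist_eq]
    exact (convex_Icc 0 M).norm_image_sub_le_of_norm_hasDerivWithin_le
      (fun z hz => (hΦ z).hasDerivWithinAt) hC (hwm y hy) (hwm x hx)
  rw [← hfac.integral_deriv_eq_sub, ← Real.norm_eq_abs]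
  refine intervalIntegral.norm_integral_le_of_norm_le hst ?_
    ((H.intervalIntegrable s t).continuousOn_mul (hG.comp H.continuous).continuousOn)
  filter_upwards [LocallyIntegrable.ae_hasDerivAt_integral H.locallyIntegrable, hwac.ae_differentiableAt] with
    x hx hx' hxm
  have hwx := (hx' (uIoc_subset_uIcc (by rwa [uIoc_of_le hst]))).hasDerivAt
  have hcomp : HasDerivAt (fun x => Φ (w x)) (G (w x) * deriv w x) x := (hΦ (w x)).comp x hwx
  rw [hcomp.deriv, Real.norm_eq_abs, abs_mul, abs_of_nonneg (hG0 _ (H.nonneg x))]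
  have := abs_deriv_le_of_abs_sub_le hwx (hx 0) fun y => H.abs_sub_le_abs x y
  rw [abs_of_nonneg (H.slope_nonneg x)] at this
  exact mul_le_mul_of_nonneg_left this (hG0 _ (H.nonneg x))

theorem comp_neg (H : IsSlopePair w h) : IsSlopePair (fun t => w (-t)) (fun t => h (-t)) where
  nonneg t := H.nonneg _
  slope_nonneg t := H.slope_nonneg _
  memLp := H.memLp.comp_measurePreserving (Measure.measurePreserving_neg volume)
  memLp_slope := H.memLp_slope.comp_measurePreserving (Measure.measurePreserving_neg volume)
  abs_sub_le s t hst := by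
    rw [intervalIntegral.integral_comp_neg, abs_sub_comm]
    exact H.abs_sub_le _ _ (by linarith)

theorem integrable_sq (H : IsSlopePair w h) : Integrable fun t => w t ^ 2 := H.memLp.integrable_sq

theorem integrable_mul (H : IsSlopePair w h) : Integrable fun t => w t * h t :=
  H.memLp.integrable_mul H.memLp_slope

/-- Otherwise `w ^ 2` would be bounded below by a positive constant on a halfline of infinite
measure. -/
theorem exists_ge_lt (H : IsSlopePair w h) {ε : ℝ} (hε : 0 < ε) (t : ℝ) : ∃ s ≥ t, w s < ε := by
  by_contra! hcon
  have h1 : IntegrableOn (fun _ : ℝ => ε ^ 2) (Ici t) := by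
    refine Integrable.mono' (H.integrable_sq.integrableOn) (by fun_prop) ?_
    rw [ae_restrict_iff' measurableSet_Ici]
    refine ae_of_all _ fun x hx => ?_
    rw [Real.norm_of_nonneg (by positivity)]
    exact pow_le_pow_left₀ hε.le (hcon x hx) 2
  simp [integrableOn_const_iff, hε.ne'] at h1

theorem tendsto_atTop (H : IsSlopePair w h) : Tendsto w atTop (𝓝 0) := by
  have hint : Integrable fun t => 2 * w t * h t := by
    simpa [mul_assoc] using H.integrable_mul.const_mul 2
  have hnn : ∀ t, 0 ≤ 2 * w t * h t := fun t =>
    mul_nonneg (mul_nonneg two_pos.le (H.nonneg t)) (H.slope_nonneg t)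
  -- The variation of `w ^ 2` from `t` to a later time where it is below `ε` controls `w t ^ 2`. The
  -- right side is the tail of an integrable function.
  have hsq : ∀ t, w t ^ 2 ≤ ∫ x in Ioi t, 2 * w x * h x := by
    intro t
    refine le_of_forall_pos_le_add fun ε hε => ?_
    obtain ⟨s, hs, hws⟩ := H.exists_ge_lt (Real.sqrt_pos.2 hε) t
    have h1 := H.abs_comp_sub_le (Φ := fun x => x ^ 2) (G := fun x => 2 * x)
      (fun x => by simpa using hasDerivAt_pow 2 x) (by fun_prop) (fun x hx => by positivity) hs
    have h2 : ∫ x in t..s, 2 * w x * h x ≤ ∫ x in Ioi t, 2 * w x * h x := by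
      rw [intervalIntegral.integral_of_le hs]
      exact setIntegral_mono_set hint.integrableOn (ae_of_all _ hnn)
        (Ioc_subset_Ioi_self.eventuallyLE)
    have h3 : w s ^ 2 < ε := by
      rw [← Real.sq_sqrt hε.le]
      exact pow_lt_pow_left₀ hws (H.nonneg s) two_ne_zero
    have := (abs_le.1 h1).1
    linarith
  have hlim : Tendsto (fun t => ∫ x in Ioi t, 2 * w x * h x) atTop (𝓝 0) := by
    have h1 := intervalIntegral_tendsto_integral_Ioi 0 hint.integrableOn tendsto_id
    have h2 : ∀ t, ∫ x in Ioi t, 2 * w x * h x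
        = (∫ x in Ioi 0, 2 * w x * h x) - ∫ x in (0 : ℝ)..t, 2 * w x * h x := by
      intro t
      rw [eq_sub_iff_add_eq, add_comm, intervalIntegral.integral_interval_add_Ioi
        hint.integrableOn hint.integrableOn]
    refine Tendsto.congr (fun t => (h2 t).symm) ?_
    have h3 := (tendsto_const_nhds (x := ∫ x in Ioi 0, 2 * w x * h x)).sub h1
    rwa [sub_self] at h3
  have : Tendsto (fun t => w t ^ 2) atTop (𝓝 0) :=
    squeeze_zero (fun t => sq_nonneg _) hsq hlim
  have := this.sqrt
  simpa [Real.sqrt_sq (H.nonneg _)] using this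

theorem tendsto_atBot (H : IsSlopePair w h) : Tendsto w atBot (𝓝 0) := by
  have := H.comp_neg.tendsto_atTop.comp tendsto_neg_atBot_atTop
  simpa [Function.comp_def] using this

theorem exists_forall_le (H : IsSlopePair w h) : ∃ x, ∀ t, w t ≤ w x := by
  by_cases h0 : ∀ t, w t = 0
  · exact ⟨0, fun t => by simp [h0]⟩
  push Not at h0
  obtain ⟨t, ht⟩ := h0
  refine H.continuous.exists_forall_ge' t ?_
  rw [cocompact_eq_atBot_atTop, eventually_sup]
  have hpos : 0 < w t := lt_of_le_of_ne (H.nonneg t) (Ne.symm ht)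
  exact ⟨(H.tendsto_atBot.eventually_lt_const hpos).mono fun _ => le_of_lt,
    (H.tendsto_atTop.eventually_lt_const hpos).mono fun _ => le_of_lt⟩

/-- This is the chain rule inequality on `[x, t]` in the limit `t → ∞`, where `Φ (w t)` tends to `Φ
0 = 0`. -/
theorem le_integral_Ioi (H : IsSlopePair w h) {Φ G : ℝ → ℝ}
    (hΦ : ∀ x, HasDerivAt Φ (G x) x) (hG : Continuous G) (hG0 : ∀ x, 0 ≤ x → 0 ≤ G x)
    (hΦ0 : Φ 0 = 0) (hi : Integrable fun t => G (w t) * h t) (x : ℝ) :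
    Φ (w x) ≤ ∫ t in Ioi x, G (w t) * h t := by
  have hΦc : Continuous Φ := continuous_iff_continuousAt.2 fun x => (hΦ x).continuousAt
  have h1 : Tendsto (fun t => Φ (w x) - Φ (w t)) atTop (𝓝 (Φ (w x) - Φ 0)) :=
    tendsto_const_nhds.sub ((hΦc.tendsto 0).comp H.tendsto_atTop)
  rw [hΦ0, sub_zero] at h1
  refine le_of_tendsto h1 ((eventually_ge_atTop x).mono fun t ht => ?_)
  have h2 : ∫ y in x..t, G (w y) * h y ≤ ∫ y in Ioi x, G (w y) * h y := by
    rw [intervalIntegral.integral_of_le ht]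
    exact setIntegral_mono_set hi.integrableOn
      (ae_of_all _ fun y => mul_nonneg (hG0 _ (H.nonneg y)) (H.slope_nonneg y))
      (Ioc_subset_Ioi_self.eventuallyLE)
  have := (abs_le.1 (H.abs_comp_sub_le hΦ hG hG0 ht)).1
  linarith

/-- A function vanishing at both ends of the line and reaching the value `w x` has total variation
at least twice that of the path from `0` to `w x`. -/
theorem two_mul_le_integral (H : IsSlopePair w h) {Φ G : ℝ → ℝ}
    (hΦ : ∀ x, HasDerivAt Φ (G x) x) (hG : Continuous G) (hG0 : ∀ x, 0 ≤ x → 0 ≤ G x)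
    (hΦ0 : Φ 0 = 0) (hi : Integrable fun t => G (w t) * h t) (x : ℝ) :
    2 * Φ (w x) ≤ ∫ t, G (w t) * h t := by
  have h1 := H.le_integral_Ioi hΦ hG hG0 hΦ0 hi x
  have h2 := H.comp_neg.le_integral_Ioi hΦ hG hG0 hΦ0 hi.comp_neg (-x)
  rw [neg_neg, integral_comp_neg_Ioi (-x) (fun t => G (w t) * h t), neg_neg] at h2
  rw [← intervalIntegral.integral_Iic_add_Ioi (b := x) hi.integrableOn hi.integrableOn]
  linarith

end IsSlopePair

end NLSGraph

namespace NLSGraph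

open Set Filter Topology

/-! ### Solitons -/

theorem integrable_cosh_rpow_neg {b : ℝ} (hb : 0 < b) :
    Integrable fun t : ℝ => Real.cosh t ^ (-b) := by
  have hc : Continuous fun t : ℝ => Real.cosh t ^ (-b) :=
    Real.continuous_cosh.rpow_const fun t => Or.inl (Real.cosh_pos t).ne'
  -- It is used with `s = t` and `s = -t`, that is, with the bound `cosh t ≥ exp |t| / 2`.
  have key : ∀ t s : ℝ, Real.exp s / 2 ≤ Real.cosh t →
      ‖Real.cosh t ^ (-b)‖ ≤ 2 ^ b * Real.exp (-b * s) := by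
    intro t s h
    rw [Real.norm_of_nonneg (Real.rpow_nonneg (Real.cosh_pos t).le _)]
    calc Real.cosh t ^ (-b) ≤ (Real.exp s / 2) ^ (-b) :=
          Real.rpow_le_rpow_of_nonpos (by positivity) h (by linarith)
      _ = 2 ^ b * Real.exp (-b * s) := by
          rw [Real.div_rpow (Real.exp_pos s).le two_pos.le, Real.rpow_neg two_pos.le,
            ← Real.exp_mul, div_inv_eq_mul, mul_comm, mul_comm s]
  rw [← integrableOn_univ, ← Iic_union_Ioi (a := (0 : ℝ))]
  refine IntegrableOn.union ?_ ?_
  · refine Integrable.mono' ((integrableOn_exp_mul_Iic hb 0).const_mul (2 ^ b))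
      hc.aestronglyMeasurable (ae_of_all _ fun t => ?_)
    have := key t (-t) (by rw [Real.cosh_eq]; linarith [Real.exp_pos t])
    rwa [neg_mul_neg] at this
  · refine Integrable.mono' ((integrableOn_exp_mul_Ioi (neg_lt_zero.2 hb) 0).const_mul (2 ^ b))
      hc.aestronglyMeasurable (ae_of_all _ fun t => ?_)
    exact key t t (by rw [Real.cosh_eq]; linarith [Real.exp_pos (-t)])

theorem hasDerivAt_tanh (x : ℝ) : HasDerivAt Real.tanh (1 - Real.tanh x ^ 2) x := by
  have h := (Real.hasDerivAt_sinh x).div (Real.hasDerivAt_cosh x) (Real.cosh_pos x).ne'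
  have e : Real.tanh = fun x => Real.sinh x / Real.cosh x :=
    funext fun x => Real.tanh_eq_sinh_div_cosh x
  rw [e]
  refine h.congr_deriv ?_
  have := (Real.cosh_pos x).ne'
  field_simp

/-- The frequency of the soliton of height `m`. -/
noncomputable def solFreq (p m : ℝ) : ℝ := 2 / p * m ^ (p - 2)

/-- The inverse width of the soliton of height `m`. -/
noncomputable def solRate (p m : ℝ) : ℝ := (p - 2) / 2 * √(solFreq p m)

/-- The even soliton of height `m`. -/
noncomputable def soliton (p m t : ℝ) : ℝ := m * Real.cosh (solRate p m * t) ^ (-(2 / (p - 2)))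

/-- The hyperbolic tangent at the scale of the soliton of height `m`. -/
noncomputable def solTanh (p m t : ℝ) : ℝ := Real.tanh (solRate p m * t)

/-- The absolute value of the slope of the soliton of height `m`, as a function of its value. -/
noncomputable def solSpeed (p m s : ℝ) : ℝ := √(solFreq p m) * s * √(1 - (s / m) ^ (p - 2))

/-- The primitive of `solSpeed`. -/
noncomputable def solPrim (p m x : ℝ) : ℝ := ∫ s in (0 : ℝ)..x, solSpeed p m s

/-- The mass of the soliton of height `m`. -/
noncomputable def solMass (p m : ℝ) : ℝ := ∫ t, soliton p m t ^ 2

/-- The derivative of the soliton of height `m`. -/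
noncomputable def solDeriv (p m t : ℝ) : ℝ := -(√(solFreq p m) * soliton p m t * solTanh p m t)

section soliton

variable {p m : ℝ}

theorem solFreq_pos (hp : 2 < p) (hm : 0 < m) : 0 < solFreq p m := by
  have : 0 < p := by linarith
  unfold solFreq; positivity

theorem solRate_pos (hp : 2 < p) (hm : 0 < m) : 0 < solRate p m :=
  mul_pos (by linarith) (Real.sqrt_pos.2 (solFreq_pos hp hm))

theorem soliton_pos (hm : 0 < m) (t : ℝ) : 0 < soliton p m t :=
  mul_pos hm (Real.rpow_pos_of_pos (Real.cosh_pos _) _)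

theorem soliton_zero : soliton p m 0 = m := by simp [soliton]

theorem soliton_neg (t : ℝ) : soliton p m (-t) = soliton p m t := by
  simp [soliton]

theorem hasDerivAt_soliton (hp : 2 < p) (t : ℝ) :
    HasDerivAt (soliton p m) (solDeriv p m t) t := by
  have hpp : p - 2 ≠ 0 := by linarith
  have h1 : HasDerivAt (fun t => solRate p m * t) (solRate p m) t := by
    simpa using (hasDerivAt_id t).const_mul (solRate p m)
  have h2 := (((Real.hasDerivAt_cosh (solRate p m * t)).comp t h1).rpow_const
    (p := -(2 / (p - 2))) (Or.inl (Real.cosh_pos _).ne')).const_mul m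
  refine h2.congr_deriv ?_
  have hc := (Real.cosh_pos (solRate p m * t)).ne'
  simp only [Function.comp_apply, solDeriv, soliton, solTanh, Real.tanh_eq_sinh_div_cosh]
  rw [Real.rpow_sub_one hc]
  have : solRate p m = (p - 2) / 2 * √(solFreq p m) := rfl
  generalize Real.cosh (solRate p m * t) = C at *
  generalize Real.sinh (solRate p m * t) = D at *
  rw [this]
  field_simp

theorem continuous_soliton (hp : 2 < p) : Continuous (soliton p m) :=
  continuous_iff_continuousAt.2 fun t => (hasDerivAt_soliton hp t).continuousAt

theorem continuous_solTanh : Continuous (solTanh p m) := by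
  have : Continuous Real.tanh := continuous_iff_continuousAt.2 fun t =>
    (hasDerivAt_tanh t).continuousAt
  exact this.comp (continuous_const.mul continuous_id)

theorem continuous_solDeriv (hp : 2 < p) : Continuous (solDeriv p m) :=
  ((continuous_const.mul (continuous_soliton hp)).mul continuous_solTanh).neg

theorem solTanh_sq_lt_one (t : ℝ) : solTanh p m t ^ 2 < 1 := by
  rw [sq_lt_one_iff_abs_lt_one]; exact Real.abs_tanh_lt_one _

/-- The exponent `-2 / (p - 2)` in the soliton turns this power into `cosh ^ (-2) = 1 - tanh ^ 2`.
The other explicit identities rest on it. -/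
theorem soliton_div_rpow (hp : 2 < p) (hm : 0 < m) (t : ℝ) :
    (soliton p m t / m) ^ (p - 2) = 1 - solTanh p m t ^ 2 := by
  have hpp : p - 2 ≠ 0 := by linarith
  have hc := Real.cosh_pos (solRate p m * t)
  rw [soliton, mul_div_cancel_left₀ _ hm.ne', ← Real.rpow_mul hc.le, solTanh,
    Real.tanh_eq_sinh_div_cosh]
  have : -(2 / (p - 2)) * (p - 2) = ((-2 : ℤ) : ℝ) := by push_cast; field_simp
  rw [this, Real.rpow_intCast]
  have h2 := Real.cosh_sq (solRate p m * t)
  rw [zpow_neg, div_pow, eq_sub_iff_add_eq, eq_comm, ← sub_eq_iff_eq_add]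
  have h3 : Real.cosh (solRate p m * t) ^ (2 : ℤ) = Real.cosh (solRate p m * t) ^ 2 := by norm_cast
  rw [h3]
  field_simp
  linarith

/-- It reduces the nonlinear term of the energy to the integrals of `soliton ^ 2` and `soliton ^ 2 *
solTanh ^ 2`, in which the kinetic term is also expressed. -/
theorem soliton_rpow (hp : 2 < p) (hm : 0 < m) (t : ℝ) :
    soliton p m t ^ p = m ^ (p - 2) * (soliton p m t ^ 2 * (1 - solTanh p m t ^ 2)) := by
  have h := soliton_pos (p := p) hm t
  rw [← soliton_div_rpow hp hm, Real.div_rpow h.le hm.le]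
  have h2 : soliton p m t ^ p = soliton p m t ^ 2 * soliton p m t ^ (p - 2) := by
    rw [← Real.rpow_natCast, ← Real.rpow_add h]; congr 1; push_cast; ring
  rw [h2]
  have := (Real.rpow_pos_of_pos hm (p - 2)).ne'
  field_simp

theorem solSpeed_soliton (hp : 2 < p) (hm : 0 < m) (t : ℝ) :
    solSpeed p m (soliton p m t) = √(solFreq p m) * soliton p m t * |solTanh p m t| := by
  rw [solSpeed, soliton_div_rpow hp hm, sub_sub_cancel, Real.sqrt_sq_eq_abs]

theorem solTanh_nonneg (hp : 2 < p) (hm : 0 < m) {t : ℝ} (ht : 0 ≤ t) : 0 ≤ solTanh p m t := by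
  rw [solTanh, Real.tanh_eq_sinh_div_cosh]
  exact div_nonneg (Real.sinh_nonneg_iff.2 (mul_nonneg (solRate_pos hp hm).le ht))
    (Real.cosh_pos _).le

theorem solTanh_pos (hp : 2 < p) (hm : 0 < m) {t : ℝ} (ht : 0 < t) : 0 < solTanh p m t := by
  rw [solTanh, Real.tanh_eq_sinh_div_cosh]
  exact div_pos (Real.sinh_pos_iff.2 (mul_pos (solRate_pos hp hm) ht)) (Real.cosh_pos _)

theorem solDeriv_eq_neg_solSpeed (hp : 2 < p) (hm : 0 < m) {t : ℝ} (ht : 0 ≤ t) :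
    solDeriv p m t = - solSpeed p m (soliton p m t) := by
  rw [solSpeed_soliton hp hm, abs_of_nonneg (solTanh_nonneg hp hm ht), solDeriv]

theorem soliton_strictAntiOn (hp : 2 < p) (hm : 0 < m) :
    StrictAntiOn (soliton p m) (Ici 0) := by
  refine strictAntiOn_of_deriv_neg (convex_Ici 0) (continuous_soliton hp).continuousOn ?_
  intro t ht
  rw [interior_Ici] at ht
  rw [(hasDerivAt_soliton hp t).deriv, solDeriv, neg_lt_zero]
  exact mul_pos (mul_pos (Real.sqrt_pos.2 (solFreq_pos hp hm)) (soliton_pos hm t))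
    (solTanh_pos hp hm ht)

theorem soliton_abs (t : ℝ) : soliton p m |t| = soliton p m t := by
  rcases abs_choice t with h | h <;> rw [h]
  exact soliton_neg t

theorem soliton_eq_iff (hp : 2 < p) (hm : 0 < m) {s t : ℝ} :
    soliton p m s = soliton p m t ↔ |s| = |t| := by
  constructor
  · intro h
    rw [← soliton_abs s, ← soliton_abs t] at h
    exact (soliton_strictAntiOn hp hm).injOn (abs_nonneg s) (abs_nonneg t) h
  · intro h
    rw [← soliton_abs s, ← soliton_abs t, h]

theorem soliton_le (hp : 2 < p) (hm : 0 < m) (t : ℝ) : soliton p m t ≤ m := by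
  have := (soliton_strictAntiOn hp hm).antitoneOn (mem_Ici.2 le_rfl) (abs_nonneg t) (abs_nonneg t)
  rwa [soliton_abs, soliton_zero] at this

theorem integrable_soliton_sq (hp : 2 < p) (hm : 0 < m) :
    Integrable fun t => soliton p m t ^ 2 := by
  have h0 : 0 < 2 / (p - 2) := div_pos two_pos (by linarith)
  have h1 := ((integrable_cosh_rpow_neg (b := 2 * (2 / (p - 2))) (by linarith)).comp_mul_left'
    (solRate_pos hp hm).ne').const_mul (m ^ 2)
  refine h1.congr (ae_of_all _ fun t => ?_)
  simp only [soliton, mul_pow]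
  rw [← Real.rpow_mul_natCast (Real.cosh_pos _).le]
  congr 2
  push_cast; ring

theorem integrable_soliton_sq_mul (hp : 2 < p) (hm : 0 < m) :
    Integrable fun t => soliton p m t ^ 2 * solTanh p m t ^ 2 := by
  refine (integrable_soliton_sq hp hm).mono' (by
    have := continuous_soliton (m := m) hp
    have := continuous_solTanh (p := p) (m := m)
    fun_prop) (ae_of_all _ fun t => ?_)
  rw [Real.norm_of_nonneg (by positivity)]
  exact mul_le_of_le_one_right (sq_nonneg _) (solTanh_sq_lt_one t).le

/-- The mass of the solitons is a power of their height. -/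
theorem exists_solMass_eq (hp : 2 < p) :
    ∃ K, 0 < K ∧ ∀ m, 0 < m → solMass p m = K * m ^ ((6 - p) / 2) := by
  have hpp : 0 < p - 2 := by linarith
  have hp0 : 0 < p := by linarith
  have h0 : 0 < 2 / (p - 2) := div_pos two_pos (by linarith)
  set I := ∫ t : ℝ, Real.cosh t ^ (-(2 * (2 / (p - 2)))) with hI
  have hIpos : 0 < I := by
    rw [hI, integral_pos_iff_support_of_nonneg
      (fun t => (Real.rpow_pos_of_pos (Real.cosh_pos t) _).le)
      (integrable_cosh_rpow_neg (by linarith))]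
    have : Function.support (fun t : ℝ => Real.cosh t ^ (-(2 * (2 / (p - 2))))) = univ :=
      eq_univ_of_forall fun t => (Real.rpow_pos_of_pos (Real.cosh_pos t) _).ne'
    rw [this]
    simp
  refine ⟨2 / (p - 2) * (√(2 / p))⁻¹ * I, by positivity, fun m hm => ?_⟩
  have h1 : ∀ t, soliton p m t ^ 2 =
      m ^ 2 * (fun s : ℝ => Real.cosh s ^ (-(2 * (2 / (p - 2))))) (solRate p m * t) := by
    intro t
    simp only [soliton, mul_pow]
    rw [← Real.rpow_mul_natCast (Real.cosh_pos _).le]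
    congr 2
    push_cast; ring
  rw [solMass]
  simp_rw [h1]
  rw [integral_const_mul, Measure.integral_comp_mul_left
    (fun s : ℝ => Real.cosh s ^ (-(2 * (2 / (p - 2))))), ← hI, smul_eq_mul,
    abs_of_pos (inv_pos.2 (solRate_pos hp hm)), solRate, solFreq, Real.sqrt_mul (by positivity),
    Real.sqrt_eq_rpow (m ^ (p - 2)), ← Real.rpow_mul hm.le]
  -- The squared amplitude gives exponent 2 and the width of the soliton gives `-(p - 2) / 2`.
  have h2 : m ^ ((6 - p) / 2) = m ^ 2 * (m ^ ((p - 2) * (1 / 2)))⁻¹ := by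
    rw [← Real.rpow_neg hm.le, ← Real.rpow_natCast, ← Real.rpow_add hm]
    congr 1; push_cast; ring
  rw [h2, mul_inv, mul_inv, inv_div]
  ring

/-- For `p < 6` the exponent `(6 - p) / 2` is nonzero, so the power law can be inverted. -/
theorem exists_solMass_eq_of_pos (hp : 2 < p) (hp6 : p < 6) {μ : ℝ} (hμ : 0 < μ) :
    ∃ m, 0 < m ∧ solMass p m = μ := by
  obtain ⟨K, hK, h⟩ := exists_solMass_eq hp
  refine ⟨(μ / K) ^ ((6 - p) / 2)⁻¹, by positivity, ?_⟩
  rw [h _ (by positivity), Real.rpow_inv_rpow (by positivity) (by linarith)]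
  field_simp

theorem solMass_pos (hp : 2 < p) (hm : 0 < m) : 0 < solMass p m := by
  obtain ⟨K, hK, h⟩ := exists_solMass_eq hp
  rw [h m hm]; positivity

/-- The kinetic energy of the soliton, as a multiple of its mass. -/
theorem integral_soliton_sq_mul (hp : 2 < p) (hm : 0 < m) :
    ∫ t, soliton p m t ^ 2 * solTanh p m t ^ 2 = (p - 2) / (p + 2) * solMass p m := by
  -- The derivative of an integrable function has zero integral if it is integrable; for this choice
  -- the result is a linear relation between the mass and the integral sought.
  have hd : ∀ t, HasDerivAt (fun t => soliton p m t ^ 2 * solTanh p m t)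
      (solRate p m * soliton p m t ^ 2 - (2 * √(solFreq p m) + solRate p m) *
        (soliton p m t ^ 2 * solTanh p m t ^ 2)) t := by
    intro t
    have h1 : HasDerivAt (fun t => solRate p m * t) (solRate p m) t := by
      simpa using (hasDerivAt_id t).const_mul (solRate p m)
    have h2 := ((hasDerivAt_soliton (m := m) hp t).pow 2).mul ((hasDerivAt_tanh _).comp t h1)
    refine h2.congr_deriv ?_
    simp only [solDeriv, Pi.pow_apply, Function.comp_apply]
    rw [← solTanh]
    push_cast
    ring
  have hi := integrable_soliton_sq hp hm
  have hi2 := integrable_soliton_sq_mul hp hm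
  have hi3 : Integrable fun t => soliton p m t ^ 2 * solTanh p m t := by
    refine hi.mono' (by
      have := continuous_soliton (m := m) hp
      have := continuous_solTanh (p := p) (m := m)
      fun_prop) (ae_of_all _ fun t => ?_)
    rw [norm_mul, Real.norm_of_nonneg (sq_nonneg (soliton p m t))]
    exact mul_le_of_le_one_right (sq_nonneg _) (Real.abs_tanh_lt_one _).le
  have h0 := integral_eq_zero_of_hasDerivAt_of_integrable hd
    ((hi.const_mul _).sub (hi2.const_mul _)) hi3
  rw [integral_sub (hi.const_mul _) (hi2.const_mul _), integral_const_mul, integral_const_mul,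
    ← solMass, solRate] at h0
  have hs := Real.sqrt_pos.2 (solFreq_pos hp hm)
  have h4 : √(solFreq p m) * ((p - 2) * solMass p m
      - (p + 2) * ∫ t, soliton p m t ^ 2 * solTanh p m t ^ 2) = 0 := by linarith
  have h5 := (mul_eq_zero.1 h4).resolve_left hs.ne'
  have : p + 2 ≠ 0 := by linarith
  field_simp
  linarith

theorem solDeriv_sq (hp : 2 < p) (hm : 0 < m) (t : ℝ) :
    solDeriv p m t ^ 2 = solFreq p m * (soliton p m t ^ 2 * solTanh p m t ^ 2) := by
  have : √(solFreq p m) ^ 2 = solFreq p m := Real.sq_sqrt (solFreq_pos hp hm).le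
  rw [solDeriv, neg_sq, mul_pow, mul_pow, this, mul_assoc]

theorem integrable_solDeriv_sq (hp : 2 < p) (hm : 0 < m) :
    Integrable fun t => solDeriv p m t ^ 2 := by
  simp_rw [solDeriv_sq hp hm]
  exact (integrable_soliton_sq_mul hp hm).const_mul _

theorem integral_solDeriv_sq (hp : 2 < p) (hm : 0 < m) :
    ∫ t, solDeriv p m t ^ 2 = solFreq p m * ((p - 2) / (p + 2) * solMass p m) := by
  simp_rw [solDeriv_sq hp hm]
  rw [integral_const_mul, integral_soliton_sq_mul hp hm]

theorem integrable_soliton_rpow (hp : 2 < p) (hm : 0 < m) :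
    Integrable fun t => soliton p m t ^ p := by
  simp_rw [soliton_rpow hp hm, mul_sub, mul_one]
  exact ((integrable_soliton_sq hp hm).const_mul _).sub
    ((integrable_soliton_sq_mul hp hm).const_mul _)

/-- The energy level of the soliton of height `m`, when its mass is `μ`. -/
noncomputable def solLevel (p m μ : ℝ) : ℝ :=
  solFreq p m * ((p - 2) / (p + 2) * solMass p m) - solFreq p m * μ / 2

theorem soliton_energy (hp : 2 < p) (hm : 0 < m) :
    1 / 2 * (∫ t, solDeriv p m t ^ 2) - 1 / p * ∫ t, soliton p m t ^ p
      = solLevel p m (solMass p m) := by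
  rw [integral_solDeriv_sq hp hm, solLevel]
  simp_rw [soliton_rpow hp hm]
  rw [integral_const_mul]
  simp_rw [mul_sub, mul_one]
  rw [integral_sub (integrable_soliton_sq hp hm) (integrable_soliton_sq_mul hp hm),
    integral_soliton_sq_mul hp hm, ← solMass, solFreq]
  have : p ≠ 0 := by linarith
  field_simp
  ring

/-- Among the heights `n`, the one for which the soliton has mass `μ` has the strictly lowest
level. -/
theorem solLevel_lt (hp : 2 < p) (hp6 : p < 6) {μ n : ℝ} (hm : 0 < m) (hn : 0 < n)
    (hμ : solMass p m = μ) (hne : n ≠ m) : solLevel p m μ < solLevel p n μ := by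
  obtain ⟨K, hK, h⟩ := exists_solMass_eq hp
  have hp0 : 0 < p := by linarith
  have hp2 : 0 < p + 2 := by linarith
  obtain ⟨r, hr, rfl⟩ : ∃ r, 0 < r ∧ n = m * r := ⟨n / m, by positivity, by field_simp⟩
  have hr1 : r ≠ 1 := fun h => hne (by rw [h, mul_one])
  have e1 : solFreq p (m * r) = solFreq p m * r ^ (p - 2) := by
    rw [solFreq, solFreq, Real.mul_rpow hm.le hr.le]; ring
  have e2 : solMass p (m * r) = μ * r ^ ((6 - p) / 2) := by
    rw [← hμ, h _ (by positivity), h _ hm, Real.mul_rpow hm.le hr.le]; ring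
  -- With `x = r ^ (p - 2)`, the frequency scales by `x` and frequency times mass by a power of `x`,
  -- so the comparison of levels becomes Bernoulli's inequality in `x`.
  have e3 : r ^ (p - 2) * r ^ ((6 - p) / 2) = (r ^ (p - 2)) ^ ((p + 2) / (2 * (p - 2))) := by
    rw [← Real.rpow_add hr, ← Real.rpow_mul hr.le]
    congr 1
    have : p - 2 ≠ 0 := by linarith
    field_simp; ring
  have hbern := one_add_mul_self_lt_rpow_one_add (s := r ^ (p - 2) - 1)
    (p := (p + 2) / (2 * (p - 2))) (by linarith [Real.rpow_pos_of_pos hr (p - 2)])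
    (by
      intro h0
      apply hr1
      have : r ^ (p - 2) = 1 := by linarith
      have h2 := congrArg (fun x => x ^ (p - 2)⁻¹) this
      simp only [Real.one_rpow] at h2
      rwa [Real.rpow_rpow_inv hr.le (by linarith)] at h2)
    -- The Bernoulli exponent `(p + 2) / (2 * (p - 2))` exceeds 1 exactly because `p < 6`.
    (by rw [lt_div_iff₀ (by linarith)]; linarith)
  rw [add_sub_cancel, ← e3] at hbern
  rw [solLevel, solLevel, e1, e2, hμ]
  have hpos : 0 < solFreq p m * μ := mul_pos (solFreq_pos hp hm) (hμ ▸ solMass_pos hp hm)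
  set x := r ^ (p - 2)
  set y := r ^ ((6 - p) / 2)
  have key : (p - 2) / (p + 2) - 1 / 2 < (p - 2) / (p + 2) * (x * y) - x / 2 := by
    have h3 := mul_lt_mul_of_pos_left hbern (div_pos (by linarith : 0 < p - 2) hp2)
    have h4 : (p - 2) / (p + 2) * (1 + (p + 2) / (2 * (p - 2)) * (x - 1))
        = (p - 2) / (p + 2) + (x - 1) / 2 := by
      have : p - 2 ≠ 0 := by linarith
      field_simp
    linarith
  nlinarith [mul_lt_mul_of_pos_left key hpos]

/-- Continuity holds on the whole line because the square root of a negative number is 0 by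
convention; in particular the speed vanishes above `m`. -/
theorem continuous_solSpeed (hp : 2 < p) : Continuous (solSpeed p m) := by
  have : Continuous fun s : ℝ => (s / m) ^ (p - 2) :=
    (continuous_id.div_const m).rpow_const fun _ => Or.inr (by linarith)
  unfold solSpeed
  fun_prop

theorem solSpeed_nonneg {s : ℝ} (hs : 0 ≤ s) : 0 ≤ solSpeed p m s := by
  unfold solSpeed; positivity

theorem solSpeed_le (hm : 0 < m) {s : ℝ} (hs : 0 ≤ s) : solSpeed p m s ≤ √(solFreq p m) * s := by
  refine mul_le_of_le_one_right (by positivity) ?_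
  rw [Real.sqrt_le_one]
  have : 0 ≤ (s / m) ^ (p - 2) := Real.rpow_nonneg (by positivity) _
  linarith

/-- This is the first integral of the soliton equation; its constant is zero because the soliton
decays, and the frequency is the one for which the speed vanishes at height `m`. -/
theorem solSpeed_sq (hp : 2 < p) (hm : 0 < m) {s : ℝ} (hs : 0 ≤ s) (hsm : s ≤ m) :
    solSpeed p m s ^ 2 / 2 + s ^ p / p = solFreq p m * s ^ 2 / 2 := by
  have h1 : (s / m) ^ (p - 2) ≤ 1 :=
    Real.rpow_le_one (by positivity) ((div_le_one hm).2 hsm) (by linarith)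
  rw [solSpeed, mul_pow, mul_pow, Real.sq_sqrt (solFreq_pos hp hm).le,
    Real.sq_sqrt (by linarith), Real.div_rpow hs hm.le, solFreq]
  have h2 : s ^ p = s ^ 2 * s ^ (p - 2) := by
    rw [← Real.rpow_natCast, ← Real.rpow_add_of_nonneg hs (by norm_num) (by linarith)]
    congr 1; push_cast; ring
  rw [h2]
  have := (Real.rpow_pos_of_pos hm (p - 2)).ne'
  have : p ≠ 0 := by linarith
  field_simp
  ring

theorem hasDerivAt_solPrim (hp : 2 < p) (x : ℝ) :
    HasDerivAt (solPrim p m) (solSpeed p m x) x :=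
  intervalIntegral.integral_hasDerivAt_right ((continuous_solSpeed hp).intervalIntegrable _ _)
    ((continuous_solSpeed hp).stronglyMeasurableAtFilter _ _) (continuous_solSpeed hp).continuousAt

theorem tendsto_soliton_atTop (hp : 2 < p) (hm : 0 < m) :
    Tendsto (soliton p m) atTop (𝓝 0) := by
  have h1 : Tendsto (fun t => Real.cosh (solRate p m * t)) atTop atTop := by
    have : Tendsto Real.cosh atTop atTop := by
      refine tendsto_atTop_mono (fun t => ?_)
        (Real.tendsto_exp_atTop.const_mul_atTop (half_pos one_pos))
      rw [Real.cosh_eq]; linarith [Real.exp_pos (-t)]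
    exact this.comp (tendsto_id.const_mul_atTop (solRate_pos hp hm))
  have h2 := ((tendsto_rpow_neg_atTop (y := 2 / (p - 2))
    (div_pos two_pos (by linarith))).comp h1).const_mul m
  rwa [mul_zero] at h2

/-- The total variation computed along the soliton. -/
theorem two_mul_solPrim (hp : 2 < p) (hm : 0 < m) :
    2 * solPrim p m m = solFreq p m * ((p - 2) / (p + 2) * solMass p m) := by
  rw [← integral_solDeriv_sq hp hm]
  have e : ∀ t, solDeriv p m t ^ 2 = (fun t => solDeriv p m t ^ 2) |t| := by
    intro t
    simp only [solDeriv_sq hp hm, soliton_abs]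
    rcases abs_choice t with h | h <;> rw [h]
    simp [solTanh]
  rw [integral_congr_ae (ae_of_all _ e), integral_comp_abs (f := fun t => solDeriv p m t ^ 2)]
  have hlim : Tendsto (fun t => - solPrim p m (soliton p m t)) atTop (𝓝 (-solPrim p m 0)) := by
    have hc : Continuous (solPrim p m) := continuous_iff_continuousAt.2 fun x =>
      (hasDerivAt_solPrim hp x).continuousAt
    exact ((hc.tendsto 0).comp (tendsto_soliton_atTop hp hm)).neg
  -- On `t ≥ 0` the soliton solves `φ' = -solSpeed φ`, so `φ' ^ 2` is the derivative of `-solPrim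
  -- φ`. By evenness the other half contributes the same.
  have h := integral_Ioi_of_hasDerivAt_of_tendsto' (a := 0)
    (f := fun t => - solPrim p m (soliton p m t)) (f' := fun t => solDeriv p m t ^ 2)
    (fun t ht => ?_) (integrable_solDeriv_sq hp hm).integrableOn hlim
  · rw [h, soliton_zero, solPrim, solPrim, intervalIntegral.integral_same]
    ring
  · have := ((hasDerivAt_solPrim (m := m) hp (soliton p m t)).comp t
      (hasDerivAt_soliton (m := m) hp t)).neg
    refine this.congr_deriv ?_
    rw [solDeriv_eq_neg_solSpeed hp hm ht]
    ring

end soliton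

end NLSGraph

namespace NLSGraph

open Set Filter Topology

/-! ### The calibration inequality and the energy on the line -/

section calibration

variable {p m : ℝ} {α : Type*} [MeasurableSpace α] {ν : Measure α} {w h : α → ℝ}

/-- A bounded square integrable function satisfies `w ^ p ≤ m ^ (p - 2) * w ^ 2`. -/
theorem integrable_rpow_of_le (hp : 2 < p) (hw : MemLp w 2 ν) (h0 : ∀ᵐ t ∂ν, 0 ≤ w t)
    (hm : ∀ᵐ t ∂ν, w t ≤ m) : Integrable (fun t => w t ^ p) ν := by
  refine Integrable.mono' (hw.integrable_sq.const_mul (m ^ (p - 2)))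
    (hw.aestronglyMeasurable.aemeasurable.pow_const p).aestronglyMeasurable ?_
  filter_upwards [h0, hm] with t h0 hm
  rw [Real.norm_of_nonneg (Real.rpow_nonneg h0 _)]
  have h2 : w t ^ p = w t ^ (p - 2) * w t ^ 2 := by
    rw [← Real.rpow_natCast, ← Real.rpow_add_of_nonneg h0 (by linarith) (by norm_num)]
    congr 1; push_cast; ring
  rw [h2]
  gcongr

theorem memLp_solSpeed (hp : 2 < p) (hm0 : 0 < m) (hw : MemLp w 2 ν) (h0 : ∀ᵐ t ∂ν, 0 ≤ w t) :
    MemLp (fun t => solSpeed p m (w t)) 2 ν := by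
  refine (hw.const_mul (√(solFreq p m))).mono
    ((continuous_solSpeed hp).comp_aestronglyMeasurable hw.aestronglyMeasurable) ?_
  filter_upwards [h0] with t h0
  rw [Real.norm_of_nonneg (solSpeed_nonneg h0), Real.norm_of_nonneg (by positivity)]
  exact solSpeed_le hm0 h0

/-- Writing `g = solSpeed p m w`, one has `h² / 2 = (h - g)² / 2 + g h - g² / 2`, and the first
integral `solSpeed_sq` absorbs `g² / 2 + w ^ p / p` into the mass term. The measure is arbitrary so
that this applies both on the line and on each edge. -/
theorem energy_eq_calibration (hp : 2 < p) (hm0 : 0 < m) (hw : MemLp w 2 ν) (hh : MemLp h 2 ν)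
    (h0 : ∀ᵐ t ∂ν, 0 ≤ w t) (hm : ∀ᵐ t ∂ν, w t ≤ m) :
    1 / 2 * (∫ t, h t ^ 2 ∂ν) - 1 / p * ∫ t, w t ^ p ∂ν
      = 1 / 2 * (∫ t, (h t - solSpeed p m (w t)) ^ 2 ∂ν) + (∫ t, solSpeed p m (w t) * h t ∂ν)
        - solFreq p m / 2 * ∫ t, w t ^ 2 ∂ν := by
  have hg := memLp_solSpeed hp hm0 hw h0
  have i1 := hh.integrable_sq
  have i2 := integrable_rpow_of_le hp hw h0 hm
  have i3 := (hh.sub hg).integrable_sq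
  have i4 : Integrable (fun t => solSpeed p m (w t) * h t) ν := hg.integrable_mul hh
  have i5 := hw.integrable_sq
  simp only [Pi.sub_apply] at i3
  simp only [← integral_const_mul]
  rw [← integral_sub (i1.const_mul _) (i2.const_mul _),
    ← integral_add (i3.const_mul _) i4, ← integral_sub (by exact (i3.const_mul _).add i4)
      (i5.const_mul _)]
  refine integral_congr_ae ?_
  filter_upwards [h0, hm] with t h0 hm
  have := solSpeed_sq hp hm0 h0 hm
  linear_combination (-1 : ℝ) * this

end calibration

/-! ### Comparison of a function with the soliton. -/

section comparison

variable {p m : ℝ} {w : ℝ → ℝ}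

theorem solSpeed_pos (hp : 2 < p) (hm : 0 < m) {s : ℝ} (hs : 0 < s) (hsm : s < m) :
    0 < solSpeed p m s := by
  have h1 : (s / m) ^ (p - 2) < 1 :=
    Real.rpow_lt_one (by positivity) ((div_lt_one hm).2 hsm) (by linarith)
  have := Real.sqrt_pos.2 (solFreq_pos hp hm)
  have := Real.sqrt_pos.2 (sub_pos.2 h1)
  unfold solSpeed; positivity

theorem soliton_lt (hp : 2 < p) (hm : 0 < m) {t : ℝ} (ht : 0 < t) : soliton p m t < m := by
  have := soliton_strictAntiOn hp hm (mem_Ici.2 le_rfl) ht.le ht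
  rwa [soliton_zero] at this

/-- A function leaving its maximum no faster than the soliton stays above it. -/
theorem soliton_le_of_nonneg (hp : 2 < p) (hm : 0 < m) (hw : Continuous w) (hw0 : w 0 = m)
    (hs : ∀ s t, s ≤ t → |w t - w s| ≤ ∫ x in s..t, solSpeed p m (w x)) {t : ℝ} (ht : 0 ≤ t) :
    soliton p m t ≤ w t := by
  -- The speed vanishes at height `m`, where the equation `φ' = -solSpeed φ` loses uniqueness. The
  -- barrier therefore starts at time `κ > 0`, past the maximum, and runs `1 + κ` times faster, so
  -- that slopes are strictly ordered at any contact; then `κ → 0`.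
  have key : ∀ κ : ℝ, 0 < κ → soliton p m (κ + (1 + κ) * t) ≤ w t := by
    intro κ hκ
    have haff : ∀ x, HasDerivAt (fun x : ℝ => κ + (1 + κ) * x) (1 + κ) x := fun x => by
      simpa using ((hasDerivAt_id x).const_mul (1 + κ)).const_add κ
    have hB : ∀ x, HasDerivAt (fun x => - soliton p m (κ + (1 + κ) * x))
        (-(solDeriv p m (κ + (1 + κ) * x) * (1 + κ))) x := fun x =>
      (HasDerivAt.comp (h₂ := soliton p m) x (hasDerivAt_soliton hp _) (haff x)).fun_neg
    have hgc : Continuous fun x => solSpeed p m (w x) := (continuous_solSpeed hp).comp hw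
    have := image_le_of_liminf_slope_right_lt_deriv_boundary (f := fun x => - w x)
      (f' := fun x => solSpeed p m (w x)) (a := 0) (b := t) hw.neg.continuousOn ?_ ?_ hB ?_
      (right_mem_Icc.2 ht)
    · linarith
    · intro x _ r hr
      refine Eventually.frequently ?_
      have hd : HasDerivAt (fun y => ∫ z in x..y, solSpeed p m (w z)) (solSpeed p m (w x)) x :=
        intervalIntegral.integral_hasDerivAt_right (hgc.intervalIntegrable _ _)
          (hgc.stronglyMeasurableAtFilter _ _) hgc.continuousAt
      have h1 := (hasDerivAt_iff_tendsto_slope.1 hd).eventually_lt_const hr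
      have h2 : 𝓝[>] x ≤ 𝓝[≠] x := nhdsWithin_mono x fun y hy => (ne_of_gt hy)
      filter_upwards [h2 h1, self_mem_nhdsWithin] with y hy hxy
      refine lt_of_le_of_lt ?_ hy
      rw [slope_def_field, slope_def_field, intervalIntegral.integral_same, sub_zero]
      have h3 := (abs_le.1 (hs x y (le_of_lt hxy))).1
      have h4 : 0 < y - x := sub_pos.2 hxy
      gcongr
      linarith
    · rw [hw0, neg_le_neg_iff]
      exact soliton_le hp hm _
    · intro x hx heq
      have hpos : 0 < κ + (1 + κ) * x := by have := hx.1; positivity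
      have heq' : w x = soliton p m (κ + (1 + κ) * x) := neg_injective heq
      have h1 := solSpeed_pos hp hm (soliton_pos (p := p) hm (κ + (1 + κ) * x))
        (soliton_lt hp hm hpos)
      rw [heq', solDeriv_eq_neg_solSpeed hp hm hpos.le]
      nlinarith
  have hlim : Tendsto (fun κ : ℝ => soliton p m (κ + (1 + κ) * t)) (𝓝[>] 0)
      (𝓝 (soliton p m (0 + (1 + 0) * t))) := by
    have : Continuous fun κ : ℝ => soliton p m (κ + (1 + κ) * t) :=
      (continuous_soliton hp).comp (by fun_prop)
    exact (this.tendsto 0).mono_left nhdsWithin_le_nhds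
  rw [zero_add, add_zero, one_mul] at hlim
  exact le_of_tendsto hlim (eventually_nhdsWithin_of_forall fun κ hκ => key κ hκ)

theorem soliton_le_of_speed (hp : 2 < p) (hm : 0 < m) (hw : Continuous w) (hw0 : w 0 = m)
    (hs : ∀ s t, s ≤ t → |w t - w s| ≤ ∫ x in s..t, solSpeed p m (w x)) (t : ℝ) :
    soliton p m t ≤ w t := by
  rcases le_total 0 t with ht | ht
  · exact soliton_le_of_nonneg hp hm hw hw0 hs ht
  · have := soliton_le_of_nonneg hp hm (w := fun t => w (-t)) (by fun_prop) (by simpa using hw0)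
      (fun s t hst => by
        rw [intervalIntegral.integral_comp_neg (fun x => solSpeed p m (w x)), abs_sub_comm]
        exact hs _ _ (by linarith)) (neg_nonneg.2 ht)
    simpa [soliton_neg] using this

end comparison

/-! ### The minimum of the energy on the line. -/

theorem _root_.IsH1On.isSlopePair {u g : ℝ → ℂ} (h : IsH1On u g univ) :
    IsSlopePair (fun t => ‖u t‖) (fun t => ‖g t‖) where
  nonneg _ := norm_nonneg _
  slope_nonneg _ := norm_nonneg _
  memLp := by simpa using h.memLp.norm
  memLp_slope := by simpa using h.memLp_deriv.norm
  abs_sub_le s t hst := by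
    refine (abs_norm_sub_norm_le _ _).trans ?_
    rw [h.sub_eq_integral (subset_univ _) hst]
    exact intervalIntegral.norm_integral_le_integral_norm hst

theorem IsSlopePair.exists_max_pos {w h : ℝ → ℝ} (H : IsSlopePair w h) {μ : ℝ} (hμ : 0 < μ)
    (hw : ∫ t, w t ^ 2 = μ) : ∃ x, 0 < w x ∧ ∀ t, w t ≤ w x := by
  obtain ⟨x, hx⟩ := H.exists_forall_le
  refine ⟨x, lt_of_le_of_ne (H.nonneg x) fun h0 => ?_, hx⟩
  have : ∀ t, w t = 0 := fun t => le_antisymm (h0 ▸ hx t) (H.nonneg t)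
  simp [this] at hw
  linarith

/-- The calibration uses the soliton with the same maximum as `w`, whose mass need not be `μ`.
Dropping the square and bounding the variation leaves the level of that height, and the height `m`
has the lowest one. -/
theorem IsSlopePair.solLevel_le {w h : ℝ → ℝ} (H : IsSlopePair w h) {p μ m : ℝ} (hp : 2 < p)
    (hp6 : p < 6) (hm : 0 < m) (hμ : 0 < μ) (hmμ : solMass p m = μ) (hw : ∫ t, w t ^ 2 = μ) :
    solLevel p m μ ≤ 1 / 2 * (∫ t, h t ^ 2) - 1 / p * ∫ t, w t ^ p := by
  obtain ⟨x, hx0, hx⟩ := H.exists_max_pos hμ hw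
  have hnn := ae_of_all volume H.nonneg
  rw [energy_eq_calibration hp hx0 H.memLp H.memLp_slope hnn (ae_of_all _ hx), hw]
  have h1 := H.two_mul_le_integral (hasDerivAt_solPrim (m := w x) hp) (continuous_solSpeed hp)
    (fun s hs => solSpeed_nonneg hs) (by simp [solPrim])
    ((memLp_solSpeed hp hx0 H.memLp hnn).integrable_mul H.memLp_slope) x
  rw [two_mul_solPrim hp hx0] at h1
  have h2 : 0 ≤ ∫ t, (h t - solSpeed p (w x) (w t)) ^ 2 := integral_nonneg fun t => sq_nonneg _
  have h3 : solLevel p m μ ≤ solLevel p (w x) μ := by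
    by_cases hne : w x = m
    · rw [hne]
    · exact (solLevel_lt hp hp6 hm hx0 hmμ hne).le
  rw [solLevel] at h3 ⊢
  rw [solLevel] at h3
  linarith

theorem isH1On_ofReal {f f' : ℝ → ℝ} {s I : Set ℝ} (hs : s.Countable) (hf : Continuous f)
    (hf' : LocallyIntegrable f') (hd : ∀ t, t ∉ s → HasDerivAt f (f' t) t)
    (hI : IntegrableOn (fun t => f t ^ 2) I) (hI' : IntegrableOn (fun t => f' t ^ 2) I) :
    IsH1On (fun t => (f t : ℂ)) (fun t => (f' t : ℂ)) I where
  continuousOn := (Complex.continuous_ofReal.comp hf).continuousOn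
  memLp := ((memLp_two_iff_integrable_sq hf.aestronglyMeasurable).2 hI).ofReal
  memLp_deriv := ((memLp_two_iff_integrable_sq
    hf'.aestronglyMeasurable.restrict).2 hI').ofReal
  hasWeakDerivOn := hasWeakDerivOn_of_hasDerivAt hs (Complex.continuous_ofReal.comp hf)
    (fun x => let ⟨s, hs, h⟩ := hf' x; ⟨s, hs, h.ofReal⟩) (fun t ht => (hd t ht).ofReal_comp) _

theorem isLeast_lineEnergyLevels {p μ m : ℝ} (hp : 2 < p) (hp6 : p < 6) (hm : 0 < m) (hμ : 0 < μ)
    (hmμ : solMass p m = μ) : IsLeast (lineEnergyLevels p μ) (solLevel p m μ) := by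
  constructor
  · refine ⟨⟨fun t => (soliton p m t : ℂ), fun t => (solDeriv p m t : ℂ),
      isH1On_ofReal countable_empty (continuous_soliton hp)
        (continuous_solDeriv hp).locallyIntegrable (fun t _ => hasDerivAt_soliton hp t)
        (integrable_soliton_sq hp hm).integrableOn (integrable_solDeriv_sq hp hm).integrableOn⟩,
      ?_, ?_⟩
    · simpa [LineH1.mass, Complex.norm_real, solMass] using hmμ
    · simp only [LineH1.energy, Complex.norm_real, Real.norm_eq_abs, sq_abs,
        abs_of_pos (soliton_pos hm _)]
      rw [soliton_energy hp hm, hmμ]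
  · rintro c ⟨u, hu, rfl⟩
    exact u.isH1On.isSlopePair.solLevel_le hp hp6 hm hμ hmμ hu

end NLSGraph

namespace MetricGraph

open Set Filter Topology

/-! ### Unrolling a trail -/

/-! ### Points of the graph and their coordinates on edges. -/

section points

variable {V E : Type*} (G : MetricGraph V E)

/-- The parameters of the interior points of an edge. -/
def openInterval (e : E) : Set ℝ := {t | 0 < t ∧ ENNReal.ofReal t < G.len e}

theorem openInterval_subset (e : E) : G.openInterval e ⊆ G.interval e :=
  fun _ ht => ⟨ht.1.le, ht.2.le⟩

theorem zero_mem_interval (e : E) : (0 : ℝ) ∈ G.interval e := ⟨le_rfl, by simp⟩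

theorem Icc_subset_interval {e : E} {s t : ℝ} (hs : s ∈ G.interval e) (ht : t ∈ G.interval e) :
    Icc s t ⊆ G.interval e := fun _ hx =>
  ⟨hs.1.trans hx.1, (ENNReal.ofReal_le_ofReal hx.2).trans ht.2⟩

theorem isClosed_interval (e : E) : IsClosed (G.interval e) :=
  isClosed_Ici.inter (isClosed_Iic.preimage ENNReal.continuous_ofReal)

theorem isOpen_openInterval (e : E) : IsOpen (G.openInterval e) :=
  isOpen_Ioi.inter (isOpen_Iio.preimage ENNReal.continuous_ofReal)

theorem toReal_len_pos {e : E} (h : ¬ G.IsHalfline e) : 0 < (G.len e).toReal :=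
  ENNReal.toReal_pos (G.len_pos e).ne' h

theorem mem_interval_iff {e : E} (h : ¬ G.IsHalfline e) {t : ℝ} :
    t ∈ G.interval e ↔ 0 ≤ t ∧ t ≤ (G.len e).toReal :=
  and_congr_right fun _ => ENNReal.ofReal_le_iff_le_toReal h

theorem mem_interval_iff_of_isHalfline {e : E} (h : G.IsHalfline e) {t : ℝ} :
    t ∈ G.interval e ↔ 0 ≤ t := by
  have h' : G.len e = ⊤ := h
  simp [interval, h']

theorem eq_zero_or_eq_len {e : E} {t : ℝ} (ht : t ∈ G.interval e) (ht' : t ∉ G.openInterval e) :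
    t = 0 ∨ t = (G.len e).toReal := by
  rcases ht.1.eq_or_lt with h | h
  · exact Or.inl h.symm
  · right
    have : ENNReal.ofReal t = G.len e := le_antisymm ht.2 (not_lt.1 fun h2 => ht' ⟨h, h2⟩)
    rw [← this, ENNReal.toReal_ofReal h.le]

theorem restrict_interval (e : E) :
    (volume.restrict (G.interval e)) = volume.restrict (G.openInterval e) := by
  refine Measure.restrict_congr_set (ae_eq_set.2 ⟨?_, ?_⟩)
  · refine measure_mono_null (t := {0, (G.len e).toReal}) (fun t ht => ?_)
      ((Set.toFinite _).measure_zero _)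
    exact G.eq_zero_or_eq_len ht.1 ht.2
  · rw [sdiff_eq_empty.2 (G.openInterval_subset e), measure_empty]

theorem pt_of_mem {e : E} {t : ℝ} (ht : t ∈ G.openInterval e) :
    G.pt e t = Sum.inr ⟨e, t, ht⟩ :=
  (dif_neg (not_le.2 ht.1)).trans (dif_pos ht.2)

theorem pt_zero (e : E) : G.pt e 0 = Sum.inl ⟨G.tail e, G.tail_notMem_atInf e⟩ :=
  dif_pos le_rfl

theorem head_notMem {e : E} (h : ¬ G.IsHalfline e) : G.head e ∉ G.atInf := fun h' =>
  h ((G.head_mem_atInf_iff e).1 h')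

theorem pt_len {e : E} (h : ¬ G.IsHalfline e) :
    G.pt e (G.len e).toReal = Sum.inl ⟨G.head e, G.head_notMem h⟩ :=
  (dif_neg (not_le.2 (G.toReal_len_pos h))).trans
    (dif_neg (by rw [ENNReal.ofReal_toReal h]; exact lt_irrefl _))

theorem mem_openInterval_of_pt_eq_inr {e e' : E} {t : ℝ}
    {t' : {t : ℝ // 0 < t ∧ ENNReal.ofReal t < G.len e'}} (h : G.pt e t = Sum.inr ⟨e', t'⟩) :
    e = e' ∧ t = t' ∧ t ∈ G.openInterval e := by
  have hm : t ∈ G.openInterval e := by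
    by_contra hm
    by_cases h1 : t ≤ 0
    · have h3 : G.pt e t = Sum.inl _ := dif_pos h1
      exact Sum.inl_ne_inr (h3.symm.trans h)
    · have h2 : ¬ ENNReal.ofReal t < G.len e := fun h2 => hm ⟨lt_of_not_ge h1, h2⟩
      have h3 : G.pt e t = Sum.inl _ := (dif_neg h1).trans (dif_neg h2)
      exact Sum.inl_ne_inr (h3.symm.trans h)
  rw [G.pt_of_mem hm] at h
  have h2 := Sum.inr_injective h
  obtain ⟨rfl, h3⟩ := Sigma.mk.inj_iff.1 h2
  exact ⟨rfl, congrArg Subtype.val (eq_of_heq h3), hm⟩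

/-- Two parametrizations of the same interior point agree. -/
theorem pt_injective {e e' : E} {t t' : ℝ} (ht : t ∈ G.openInterval e)
    (h : G.pt e t = G.pt e' t') : e = e' ∧ t = t' := by
  rw [G.pt_of_mem ht] at h
  obtain ⟨h1, h2, -⟩ := G.mem_openInterval_of_pt_eq_inr h.symm
  exact ⟨h1.symm, h2.symm⟩

/-- The first point of an oriented edge (meaningful if it is not at infinity). -/
noncomputable def startPt (d : E × Bool) : G.Point := G.pt d.1 (if d.2 then 0 else (G.len d.1).toReal)

/-- The last point of an oriented edge (meaningful if it is not at infinity). -/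
noncomputable def endPt (d : E × Bool) : G.Point := G.pt d.1 (if d.2 then (G.len d.1).toReal else 0)

theorem startPt_eq (d : E × Bool) (h : G.source d ∉ G.atInf) :
    G.startPt d = Sum.inl ⟨G.source d, h⟩ := by
  obtain ⟨e, b⟩ := d
  cases b
  · have : ¬ G.IsHalfline e := fun h' => h ((G.head_mem_atInf_iff e).2 h')
    exact G.pt_len this
  · exact G.pt_zero e

theorem endPt_eq (d : E × Bool) (h : G.target d ∉ G.atInf) :
    G.endPt d = Sum.inl ⟨G.target d, h⟩ := by
  obtain ⟨e, b⟩ := d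
  cases b
  · exact G.pt_zero e
  · have : ¬ G.IsHalfline e := fun h' => h ((G.head_mem_atInf_iff e).2 h')
    exact G.pt_len this

theorem target_notMem {d : E × Bool} (h : ¬ G.IsHalfline d.1) : G.target d ∉ G.atInf := by
  obtain ⟨e, b⟩ := d
  cases b
  · exact G.tail_notMem_atInf e
  · exact G.head_notMem h

theorem endPt_eq_startPt {d d' : E × Bool} (h : G.target d ∉ G.atInf)
    (hd : G.target d = G.source d') : G.endPt d = G.startPt d' := by
  have h' : G.source d' ∉ G.atInf := hd ▸ h
  rw [G.endPt_eq d h, G.startPt_eq d' h']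
  congr 2

end points

section unrolling

variable {V E : Type*} (G : MetricGraph V E)

/-- `γ` runs through the edges of `T` with unit speed, `e` being parametrized by
`γ (a e + ε e * t)`, and these pieces cover the line. -/
structure IsUnrolling (T : Finset E) (γ : ℝ → G.Point) (a ε : E → ℝ) : Prop where
  sign : ∀ e, ε e = 1 ∨ ε e = -1
  map_eq : ∀ e ∈ T, ∀ t ∈ G.interval e, γ (a e + ε e * t) = G.pt e t
  cover : ∀ s, ∃ e ∈ T, ∃ t ∈ G.interval e, s = a e + ε e * t

/-- A vertex at infinity has degree one, so a trail that arrives there could continue only by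
repeating the same edge. -/
theorem eq_append_of_isHalfline_true {l : List (E × Bool)} (hl : G.IsTrail l) {e : E}
    (he : G.IsHalfline e) (h : (e, true) ∈ l) : ∃ l0, l = l0 ++ [(e, true)] := by
  obtain ⟨s, t, rfl⟩ := List.append_of_mem h
  cases t with
  | nil => exact ⟨s, rfl⟩
  | cons d t =>
    exfalso
    obtain ⟨hc, hn⟩ := hl
    have h1 : G.target (e, true) = G.source d :=
      (List.isChain_cons_cons.1 (List.isChain_append.1 hc).2.1).1
    have h2 : G.head e ∈ G.atInf := (G.head_mem_atInf_iff e).2 he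
    obtain ⟨e', b⟩ := d
    have h3 : G.head e = G.head e' := by
      cases b
      · exact h1
      · exact absurd ((show G.head e = G.tail e' from h1) ▸ h2) (G.tail_notMem_atInf e')
    have h4 : e = e' := (G.existsUnique_edge_atInf _ h2).unique rfl h3.symm
    subst h4
    simp [List.nodup_append] at hn

theorem eq_cons_of_isHalfline_false {l : List (E × Bool)} (hl : G.IsTrail l) {e : E}
    (he : G.IsHalfline e) (h : (e, false) ∈ l) : ∃ l0, l = (e, false) :: l0 := by
  obtain ⟨s, t, rfl⟩ := List.append_of_mem h
  rcases s.eq_nil_or_concat with rfl | ⟨s, d, rfl⟩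
  · exact ⟨t, rfl⟩
  · exfalso
    obtain ⟨hc, hn⟩ := hl
    have h1 : G.target d = G.source (e, false) := by
      refine (List.isChain_append.1 hc).2.2 d (by simp) (e, false) (by simp)
    have h2 : G.head e ∈ G.atInf := (G.head_mem_atInf_iff e).2 he
    obtain ⟨e', b⟩ := d
    have h3 : G.head e = G.head e' := by
      cases b
      · exact absurd ((show G.tail e' = G.head e from h1).symm ▸ h2) (G.tail_notMem_atInf e')
      · exact h1.symm
    have h4 : e = e' := (G.existsUnique_edge_atInf _ h2).unique rfl h3.symm
    subst h4
    simp [List.nodup_append] at hn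

/-- A trail with two halflines comes from infinity along the first one, then runs through bounded
edges and goes to infinity along the second one. -/
theorem exists_eq_of_two_halflines {l : List (E × Bool)} (hl : G.IsTrail l)
    (h : ∃ e ∈ l.map Prod.fst, ∃ e' ∈ l.map Prod.fst, e ≠ e' ∧ G.IsHalfline e ∧ G.IsHalfline e') :
    ∃ e e' l0, l = (e, false) :: (l0 ++ [(e', true)]) ∧ G.IsHalfline e ∧ G.IsHalfline e' ∧
      ∀ d ∈ l0, ¬ G.IsHalfline d.1 := by
  have main : ∃ e e', G.IsHalfline e ∧ G.IsHalfline e' ∧ (e, false) ∈ l ∧ (e', true) ∈ l ∧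
      e ≠ e' := by
    obtain ⟨e, he, e', he', hne, hh, hh'⟩ := h
    simp only [List.mem_map, Prod.exists, exists_and_right, exists_eq_right] at he he'
    obtain ⟨b, hb⟩ := he
    obtain ⟨b', hb'⟩ := he'
    cases b <;> cases b'
    · obtain ⟨l0, rfl⟩ := G.eq_cons_of_isHalfline_false hl hh hb
      obtain ⟨l1, h1⟩ := G.eq_cons_of_isHalfline_false hl hh' hb'
      simp only [List.cons.injEq, Prod.mk.injEq] at h1
      exact absurd h1.1.1 hne
    · exact ⟨e, e', hh, hh', hb, hb', hne⟩
    · exact ⟨e', e, hh', hh, hb', hb, hne.symm⟩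
    · obtain ⟨l0, rfl⟩ := G.eq_append_of_isHalfline_true hl hh hb
      obtain ⟨l1, h1⟩ := G.eq_append_of_isHalfline_true hl hh' hb'
      have := (List.append_inj' h1 rfl).2
      simp only [List.cons.injEq, Prod.mk.injEq] at this
      exact absurd this.1.1 hne
  obtain ⟨e, e', hh, hh', hb, hb', hne⟩ := main
  obtain ⟨r, rfl⟩ := G.eq_cons_of_isHalfline_false hl hh hb
  obtain ⟨l1, h1⟩ := G.eq_append_of_isHalfline_true hl hh' hb'
  cases l1 with
  | nil =>
    simp at h1
  | cons d l0 =>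
    simp only [List.cons_append, List.cons.injEq] at h1
    obtain ⟨rfl, rfl⟩ := h1
    refine ⟨e, e', l0, rfl, hh, hh', fun d hd hdh => ?_⟩
    obtain ⟨e'', b⟩ := d
    have hn := hl.2
    cases b
    · obtain ⟨r, hr⟩ := G.eq_cons_of_isHalfline_false hl hdh (by simp [hd])
      simp only [List.cons.injEq, Prod.mk.injEq] at hr
      obtain ⟨⟨rfl, -⟩, -⟩ := hr
      simp only [List.map_cons, List.nodup_cons, List.mem_map] at hn
      exact hn.1 ⟨_, List.mem_append_left _ hd, rfl⟩
    · obtain ⟨r, hr⟩ := G.eq_append_of_isHalfline_true hl hdh (by simp [hd])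
      rw [← List.cons_append] at hr
      have := (List.append_inj' hr rfl).2
      simp only [List.cons.injEq, Prod.mk.injEq] at this
      obtain ⟨⟨rfl, -⟩, -⟩ := this
      simp only [List.map_cons, List.nodup_cons, List.map_append, List.nodup_append] at hn
      exact hn.2.2.2 e' (List.mem_map.2 ⟨_, hd, rfl⟩) e' (by simp) rfl

-- The bounded edges are prepended one at a time: the new edge, of length `L`, occupies `[s0, s0 +
-- L]` and the rest starts at `s0 + L`. The clause on the starting point makes the pieces agree at
-- the common vertex. An edge run backwards has `ε = -1` and its tail at time `s0 + L`.
open Classical in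
theorem exists_halfline_unrolling {e' : E} (he' : G.IsHalfline e') (l0 : List (E × Bool))
    (hc : (l0 ++ [(e', true)]).IsChain fun d d' => G.target d = G.source d')
    (hn : ((l0 ++ [(e', true)]).map Prod.fst).Nodup) (hl0 : ∀ d ∈ l0, ¬ G.IsHalfline d.1) (s0 : ℝ) :
    ∃ (γ : ℝ → G.Point) (a ε : E → ℝ), (∀ e, ε e = 1 ∨ ε e = -1) ∧
      (∀ d ∈ (l0 ++ [(e', true)]).head?, γ s0 = G.startPt d) ∧
      (∀ e ∈ (l0 ++ [(e', true)]).map Prod.fst, ∀ t ∈ G.interval e,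
        s0 ≤ a e + ε e * t ∧ γ (a e + ε e * t) = G.pt e t) ∧
      ∀ s, s0 ≤ s → ∃ e ∈ (l0 ++ [(e', true)]).map Prod.fst, ∃ t ∈ G.interval e,
        s = a e + ε e * t := by
  induction l0 generalizing s0 with
  | nil =>
    refine ⟨fun s => G.pt e' (s - s0), fun _ => s0, fun _ => 1, fun _ => Or.inl rfl, ?_, ?_, ?_⟩
    · intro d hd
      simp only [List.nil_append, List.head?_cons, Option.mem_def, Option.some.injEq] at hd
      subst hd
      simp [startPt]
    · intro e he t ht
      simp only [List.nil_append, List.map_cons, List.map_nil, List.mem_singleton] at he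
      subst he
      exact ⟨by linarith [ht.1], by simp⟩
    · intro s hs
      exact ⟨e', by simp, s - s0, (G.mem_interval_iff_of_isHalfline he').2 (by linarith), by ring⟩
  | cons d l0 ih =>
    obtain ⟨e, b⟩ := d
    set r := l0 ++ [(e', true)] with hr
    have hL : ¬ G.IsHalfline e := hl0 (e, b) (by simp)
    have hLpos := G.toReal_len_pos hL
    set L := (G.len e).toReal with hLdef
    rw [List.cons_append, List.isChain_cons] at hc
    rw [List.cons_append, List.map_cons, List.nodup_cons] at hn
    obtain ⟨γ, a, ε, hε, hstart, hmap, hcov⟩ := ih hc.2 hn.2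
      (fun d hd => hl0 d (List.mem_cons_of_mem _ hd)) (s0 + L)
    have hend : G.endPt (e, b) = γ (s0 + L) := by
      have : ∃ d, d ∈ r.head? := by
        rw [hr]; cases l0 <;> simp
      obtain ⟨d, hd⟩ := this
      rw [hstart d hd]
      exact G.endPt_eq_startPt (G.target_notMem hL) (hc.1 d hd)
    refine ⟨fun s => if s ≤ s0 + L then G.pt e (if b then s - s0 else s0 + L - s) else γ s,
      Function.update a e (if b then s0 else s0 + L), Function.update ε e (if b then 1 else -1),
      ?_, ?_, ?_, ?_⟩
    · intro f
      by_cases hf : f = e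
      · subst hf; rw [Function.update_self]; cases b <;> simp
      · rw [Function.update_of_ne hf]; exact hε f
    · intro d hd
      simp only [List.cons_append, List.head?_cons, Option.mem_def, Option.some.injEq] at hd
      subst hd
      refine (if_pos (by linarith)).trans ?_
      rw [startPt]
      cases b <;> simp [hLdef]
    · intro f hf t ht
      rw [List.cons_append, List.map_cons, List.mem_cons] at hf
      by_cases hfe : f = e
      · subst hfe
        rw [Function.update_self, Function.update_self]
        have h1 := (G.mem_interval_iff hL).1 ht
        cases b
        · simp only [Bool.false_eq_true, if_false]
          refine ⟨by linarith [h1.2], ?_⟩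
          rw [if_pos (by linarith [h1.1])]
          congr 1; ring
        · simp only [if_true]
          refine ⟨by linarith [h1.1], ?_⟩
          rw [if_pos (by linarith [h1.2])]
          congr 1; ring
      · rw [Function.update_of_ne hfe, Function.update_of_ne hfe]
        obtain ⟨h1, h2⟩ := hmap f (hf.resolve_left hfe) t ht
        refine ⟨by linarith, ?_⟩
        -- Only the junction time belongs both to the new edge and to the rest.
        by_cases h3 : a f + ε f * t ≤ s0 + L
        · have h5 : a f + ε f * t = s0 + L := le_antisymm h3 h1
          refine (if_pos h3).trans ?_
          rw [← h2, h5, ← hend, endPt]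
          cases b <;> simp [hLdef]
        · exact (if_neg h3).trans h2
    · intro s hs
      rcases le_total s (s0 + L) with h1 | h1
      · refine ⟨e, by simp, if b then s - s0 else s0 + L - s, ?_, ?_⟩
        · rw [G.mem_interval_iff hL]
          cases b
          · simp only [Bool.false_eq_true, if_false]; constructor <;> linarith
          · simp only [if_true]; constructor <;> linarith
        · rw [Function.update_self, Function.update_self]
          cases b
          · simp only [Bool.false_eq_true, if_false]; ring
          · simp only [if_true]; ring
      · obtain ⟨f, hf, t, ht, hst⟩ := hcov s h1
        have hfe : f ≠ e := fun h => hn.1 (h ▸ hf)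
        refine ⟨f, by rw [List.cons_append, List.map_cons]; exact List.mem_cons_of_mem _ hf, t, ht,
          ?_⟩
        rw [Function.update_of_ne hfe, Function.update_of_ne hfe]
        exact hst

-- The incoming halfline, run backwards, is placed on `(-∞, 0]`, and the rest of the trail on `[0,
-- ∞)`.
open Classical in
theorem exists_isUnrolling {l : List (E × Bool)} (hl : G.IsTrail l)
    (h : ∃ e ∈ l.map Prod.fst, ∃ e' ∈ l.map Prod.fst, e ≠ e' ∧ G.IsHalfline e ∧ G.IsHalfline e') :
    ∃ γ a ε, G.IsUnrolling (l.map Prod.fst).toFinset γ a ε := by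
  obtain ⟨e, e', l0, rfl, he, he', hl0⟩ := G.exists_eq_of_two_halflines hl h
  obtain ⟨hc, hn⟩ := hl
  rw [List.isChain_cons] at hc
  rw [List.map_cons, List.nodup_cons] at hn
  obtain ⟨γ, a, ε, hε, hstart, hmap, hcov⟩ :=
    G.exists_halfline_unrolling he' l0 hc.2 hn.2 hl0 0
  have hend : G.pt e 0 = γ 0 := by
    have : ∃ d, d ∈ (l0 ++ [(e', true)]).head? := by
      cases l0 <;> simp
    obtain ⟨d, hd⟩ := this
    rw [hstart d hd]
    exact G.endPt_eq_startPt (d := (e, false)) (G.tail_notMem_atInf e) (hc.1 d hd)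
  refine ⟨fun s => if s ≤ 0 then G.pt e (-s) else γ s, Function.update a e 0,
    Function.update ε e (-1), ?_, ?_, ?_⟩
  · intro f
    by_cases hf : f = e
    · subst hf; simp
    · rw [Function.update_of_ne hf]; exact hε f
  · intro f hf t ht
    rw [List.mem_toFinset, List.map_cons, List.mem_cons] at hf
    by_cases hfe : f = e
    · subst hfe
      rw [Function.update_self, Function.update_self, if_pos (by linarith [ht.1])]
      congr 1; ring
    · rw [Function.update_of_ne hfe, Function.update_of_ne hfe]
      obtain ⟨h1, h2⟩ := hmap f (hf.resolve_left hfe) t ht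
      split_ifs with h3
      · have h5 : a f + ε f * t = 0 := le_antisymm h3 h1
        rw [← h2, h5, neg_zero, hend]
      · exact h2
  · intro s
    rcases le_total s 0 with h1 | h1
    · refine ⟨e, by simp, -s, (G.mem_interval_iff_of_isHalfline he).2 (by linarith), ?_⟩
      rw [Function.update_self, Function.update_self]; ring
    · obtain ⟨f, hf, t, ht, hst⟩ := hcov s h1
      have hfe : f ≠ e := fun h => hn.1 (h ▸ hf)
      refine ⟨f, by rw [List.mem_toFinset, List.map_cons]; exact List.mem_cons_of_mem _ hf, t, ht,
        ?_⟩
      rw [Function.update_of_ne hfe, Function.update_of_ne hfe]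
      exact hst

/-- Under Assumption (H), every edge belongs to an unrolled trail. -/
theorem AssumptionH.exists_isUnrolling {G : MetricGraph V E} (hH : G.AssumptionH) (e : E) :
    ∃ T γ a ε, e ∈ T ∧ G.IsUnrolling T γ a ε := by
  classical
  -- An interior point of `e` lies on no other edge, so the trail through it must contain `e`.
  obtain ⟨t, ht⟩ : (G.openInterval e).Nonempty := by
    obtain ⟨q, hq0, hq⟩ := ENNReal.lt_iff_exists_nnreal_btwn.1 (G.len_pos e)
    exact ⟨q, by simpa using hq0, by simpa using hq⟩
  obtain ⟨l, hl, ⟨e', he', t', -, ht'⟩, h2⟩ := hH (G.pt e t)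
  have hee := (G.pt_injective ht ht'.symm).1
  obtain ⟨γ, a, ε, h⟩ := G.exists_isUnrolling hl h2
  exact ⟨_, γ, a, ε, by rw [List.mem_toFinset, hee]; exact he', h⟩

end unrolling

end MetricGraph

namespace MetricGraph

open Set Filter Topology NLSGraph

/-! ### Transport of functions and integrals along an unrolling -/

theorem measurePreserving_add_mul {ε : ℝ} (hε : ε = 1 ∨ ε = -1) (a : ℝ) :
    MeasurePreserving (fun t : ℝ => a + ε * t) := by
  rcases hε with rfl | rfl
  · simpa using measurePreserving_add_left volume a
  · simpa [Function.comp_def] using (measurePreserving_add_left volume a).comp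
      (Measure.measurePreserving_neg (volume : Measure ℝ))

theorem mul_self_eq_one_of_sign {ε : ℝ} (hε : ε = 1 ∨ ε = -1) : ε * ε = 1 := by
  rcases hε with rfl | rfl <;> norm_num

theorem measurableEmbedding_add_mul {ε : ℝ} (hε : ε = 1 ∨ ε = -1) (a : ℝ) :
    MeasurableEmbedding (fun t : ℝ => a + ε * t) := by
  refine Continuous.measurableEmbedding (by fun_prop) fun s t h => ?_
  have h1 : ε * s = ε * t := by simpa using h
  have := congrArg (ε * ·) h1
  simpa only [← mul_assoc, mul_self_eq_one_of_sign hε, one_mul] using this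

variable {V E : Type*} {G : MetricGraph V E}

/-- If the edges of `T` have disjoint pieces covering almost all of the line, then the measure of
the line is the sum of those of the pieces. -/
theorem volume_eq_sum_map {T : Finset E} {a ε : E → ℝ} (hε : ∀ e, ε e = 1 ∨ ε e = -1)
    (hdisj : ∀ e ∈ T, ∀ e' ∈ T, ∀ t ∈ G.openInterval e, ∀ t' ∈ G.openInterval e',
      a e + ε e * t = a e' + ε e' * t' → e = e')
    (hcov : ∀ᵐ s : ℝ, ∃ e ∈ T, ∃ t ∈ G.openInterval e, s = a e + ε e * t) :
    (volume : Measure ℝ) = Measure.sum fun e : T =>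
      (volume.restrict (G.interval e)).map fun t => a e + ε e * t := by
  rw [Measure.sum_coe_finset T fun e => (volume.restrict (G.interval e)).map fun t => a e + ε e * t]
  ext A hA
  simp only [Measure.coe_finsetSum, Finset.sum_apply]
  set J : E → Set ℝ := fun e => (fun t => a e + ε e * t) '' G.openInterval e with hJ
  have hJm : ∀ e, MeasurableSet (J e) := fun e =>
    (measurableEmbedding_add_mul (hε e) (a e)).measurableSet_image.2
      (G.isOpen_openInterval e).measurableSet
  have h1 : ∀ e ∈ T, ((volume.restrict (G.interval e)).map fun t => a e + ε e * t) A
      = volume (A ∩ J e) := by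
    intro e _
    have hemb := measurableEmbedding_add_mul (hε e) (a e)
    rw [hemb.map_apply, G.restrict_interval,
      Measure.restrict_apply (hemb.measurable hA),
      ← (measurePreserving_add_mul (hε e) (a e)).measure_preimage_emb hemb (A ∩ J e),
      preimage_inter, hJ, preimage_image_eq _ hemb.injective]
  rw [Finset.sum_congr rfl h1, ← measure_biUnion_finset]
  · refine measure_congr ?_
    rw [← inter_iUnion₂]
    filter_upwards [hcov] with s hs
    obtain ⟨e, he, t, ht, rfl⟩ := hs
    refine propext ⟨fun hA => ⟨hA, ?_⟩, fun h => h.1⟩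
    exact mem_iUnion₂.2 ⟨e, he, ⟨t, ht, rfl⟩⟩
  · intro e he e' he' hne
    refine Set.disjoint_left.2 ?_
    rintro x ⟨-, t, ht, rfl⟩ ⟨-, t', ht', heq⟩
    exact hne (hdisj e he e' he' t ht t' ht' heq.symm)
  · exact fun e _ => hA.inter (hJm e)

/-- The function on the line whose value on the piece of `e` is `f e`. -/
noncomputable def unroll {X : Type*} [Zero X] (γ : ℝ → G.Point) (f : E → ℝ → X) (s : ℝ) : X :=
  match γ s with
  | Sum.inl _ => 0
  | Sum.inr ⟨e, t⟩ => f e t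

namespace IsUnrolling

variable {T : Finset E} {γ : ℝ → G.Point} {a ε : E → ℝ}

theorem eq_of_eq (h : G.IsUnrolling T γ a ε) {e e' : E} (he : e ∈ T) (he' : e' ∈ T) {t t' : ℝ}
    (ht : t ∈ G.openInterval e) (ht' : t' ∈ G.interval e')
    (heq : a e + ε e * t = a e' + ε e' * t') : e = e' ∧ t = t' := by
  refine G.pt_injective ht ?_
  rw [← h.map_eq e he t (G.openInterval_subset e ht), heq, h.map_eq e' he' t' ht']

/-- The path `γ` passes through a vertex only finitely often. -/
theorem finite_vertexTimes (h : G.IsUnrolling T γ a ε) :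
    {s : ℝ | ¬ ∃ e ∈ T, ∃ t ∈ G.openInterval e, s = a e + ε e * t}.Finite := by
  refine Set.Finite.subset (T.finite_toSet.biUnion fun e _ =>
    (Set.toFinite {a e + ε e * 0, a e + ε e * (G.len e).toReal})) fun s hs => ?_
  obtain ⟨e, he, t, ht, rfl⟩ := h.cover s
  refine mem_iUnion₂.2 ⟨e, he, ?_⟩
  rcases G.eq_zero_or_eq_len ht fun ht' => hs ⟨e, he, t, ht', rfl⟩ with rfl | rfl
  · exact Or.inl rfl
  · exact Or.inr rfl

theorem volume_eq (h : G.IsUnrolling T γ a ε) :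
    (volume : Measure ℝ) = Measure.sum fun e : T =>
      (volume.restrict (G.interval e)).map fun t => a e + ε e * t := by
  refine volume_eq_sum_map h.sign (fun e he e' he' t ht t' ht' heq =>
    (h.eq_of_eq he he' ht (G.openInterval_subset e' ht') heq).1) ?_
  rw [ae_iff]
  exact h.finite_vertexTimes.measure_zero _

theorem unroll_apply {X : Type*} [Zero X] (h : G.IsUnrolling T γ a ε) (f : E → ℝ → X) {e : E}
    (he : e ∈ T) {t : ℝ} (ht : t ∈ G.openInterval e) : unroll γ f (a e + ε e * t) = f e t := by
  rw [unroll, h.map_eq e he t (G.openInterval_subset e ht), G.pt_of_mem ht]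

end IsUnrolling

section transport

variable {T : Finset E} {a ε : E → ℝ} (hε : ∀ e, ε e = 1 ∨ ε e = -1)
  (hvol : (volume : Measure ℝ) = Measure.sum fun e : T =>
      (volume.restrict (G.interval e)).map fun t => a e + ε e * t)

include hε hvol

theorem integral_eq_sum_edges {F : ℝ → ℝ} (hF : Integrable F) :
    ∫ s, F s = ∑ e ∈ T, ∫ t in G.interval e, F (a e + ε e * t) := by
  rw [hvol] at hF
  conv_lhs => rw [hvol]
  rw [← (hasSum_integral_measure hF).tsum_eq, tsum_fintype]
  exact (Finset.sum_congr rfl fun (e : T) _ =>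
    (measurableEmbedding_add_mul (hε e) (a e)).integral_map F).trans
      (Finset.sum_coe_sort T fun e => ∫ t in G.interval e, F (a e + ε e * t))

theorem memLp_two_of_edges {F : ℝ → ℂ}
    (hF : ∀ e ∈ T, MemLp (fun t => F (a e + ε e * t)) 2 (volume.restrict (G.interval e))) :
    MemLp F 2 := by
  have hm : AEStronglyMeasurable F := by
    rw [hvol, aestronglyMeasurable_sum_measure_iff]
    intro e
    exact (measurableEmbedding_add_mul (hε e) (a e)).aestronglyMeasurable_map_iff.2
      (hF e e.2).aestronglyMeasurable
  rw [memLp_two_iff_integrable_sq_norm hm, hvol, Measure.sum_coe_finset T fun e =>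
    (volume.restrict (G.interval e)).map fun t => a e + ε e * t, integrable_finsetSum_measure]
  intro e he
  rw [(measurableEmbedding_add_mul (hε e) (a e)).integrable_map_iff]
  exact (memLp_two_iff_integrable_sq_norm (hF e he).aestronglyMeasurable).1 (hF e he)

end transport

theorem H1.memLp (u : G.H1) (e : E) :
    MemLp (fun t => ‖u.toFun (G.pt e t)‖) 2 (volume.restrict (G.interval e)) :=
  (u.isH1On e).memLp.norm

theorem H1.memLp_slope (u : G.H1) (e : E) :
    MemLp (fun t => ‖u.weakDeriv e t‖) 2 (volume.restrict (G.interval e)) :=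
  (u.isH1On e).memLp_deriv.norm

namespace IsUnrolling

variable {T : Finset E} {γ : ℝ → G.Point} {a ε : E → ℝ}

/-- The pieces form a finite closed cover of the line and `u` is continuous on each edge;
single-valuedness of `u` at vertices does the gluing. -/
theorem continuous_comp (h : G.IsUnrolling T γ a ε) (u : G.H1) :
    Continuous fun s => u.toFun (γ s) := by
  set J : T → Set ℝ := fun e => (fun s => ε e * (s - a e)) ⁻¹' G.interval e with hJ
  have hinv : ∀ (e : E) (s : ℝ), s = a e + ε e * (ε e * (s - a e)) := fun e s => by
    rw [← mul_assoc, mul_self_eq_one_of_sign (h.sign e)]; ring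
  refine LocallyFinite.continuous (f := J) (locallyFinite_of_finite J) ?_ ?_ ?_
  · refine eq_univ_of_forall fun s => ?_
    obtain ⟨e, he, t, ht, rfl⟩ := h.cover s
    refine mem_iUnion.2 ⟨⟨e, he⟩, ?_⟩
    simp only [hJ, mem_preimage, add_sub_cancel_left, ← mul_assoc,
      mul_self_eq_one_of_sign (h.sign e), one_mul]
    exact ht
  · exact fun e => (G.isClosed_interval e).preimage (by fun_prop)
  · intro e
    have h1 : ContinuousOn (fun s => u.toFun (G.pt e (ε e * (s - a e)))) (J e) :=
      (u.isH1On e).continuousOn.comp (f := fun s => ε e * (s - a e))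
        (by fun_prop) (fun s hs => hs)
    refine h1.congr fun s hs => ?_
    simp only
    rw [← h.map_eq e e.2 _ hs, ← hinv]

theorem sub_eq_integral (h : G.IsUnrolling T γ a ε) (u : G.H1)
    (hloc : LocallyIntegrable (unroll γ fun e t => (ε e : ℂ) * u.weakDeriv e t)) {s t : ℝ} :
    u.toFun (γ t) - u.toFun (γ s)
      = ∫ x in s..t, unroll γ (fun e t => (ε e : ℂ) * u.weakDeriv e t) x := by
  set H := unroll γ fun e t => (ε e : ℂ) * u.weakDeriv e t with hH
  have hii : ∀ x y, IntervalIntegrable H volume x y := fun x y =>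
    (intervalIntegrable_iff').2 (hloc.integrableOn_isCompact isCompact_uIcc)
  set D : ℝ → ℂ := fun s => u.toFun (γ s) - ∫ x in (0 : ℝ)..s, H x with hD
  have hDc : Continuous D := (h.continuous_comp u).sub (intervalIntegral.continuous_primitive hii 0)
  -- `D` is constant on each piece by the fundamental theorem on the edge. It is therefore
  -- continuous with finite range, hence constant, and the order of the pieces along the line plays
  -- no role.
  have key : ∀ e ∈ T, ∀ t ∈ G.interval e, D (a e + ε e * t) = D (a e + ε e * 0) := by
    intro e he t ht
    have h1 := (u.isH1On e).sub_eq_integral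
      (G.Icc_subset_interval (G.zero_mem_interval e) ht) ht.1
    have h2 : ∫ x in (a e + ε e * 0)..(a e + ε e * t), H x = ∫ x in (0 : ℝ)..t, u.weakDeriv e x := by
      have h3 := intervalIntegral.smul_integral_comp_add_mul (a := 0) (b := t) H (ε e) (a e)
      rw [← h3, ← intervalIntegral.integral_smul]
      refine intervalIntegral.integral_congr_ae ?_
      -- The endpoint `t` may be a vertex, where `unroll` is zero by convention.
      have : ∀ᵐ x : ℝ, x ≠ t := by simp [ae_iff]
      filter_upwards [this] with x hx hx'
      rw [uIoc_of_le ht.1] at hx'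
      have hxm : x ∈ G.openInterval e := by
        refine ⟨hx'.1, lt_of_lt_of_le ?_ ht.2⟩
        exact (ENNReal.ofReal_lt_ofReal_iff (hx'.1.trans_le hx'.2)).2 (lt_of_le_of_ne hx'.2 hx)
      rw [hH, h.unroll_apply _ he hxm, Complex.real_smul, ← mul_assoc, ← Complex.ofReal_mul,
        mul_self_eq_one_of_sign (h.sign e), Complex.ofReal_one, one_mul]
    simp only [hD]
    rw [h.map_eq e he t ht, h.map_eq e he 0 (G.zero_mem_interval e)]
    have h4 := intervalIntegral.integral_add_adjacent_intervals (hii 0 (a e + ε e * 0))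
      (hii (a e + ε e * 0) (a e + ε e * t))
    rw [← h4, h2, ← h1]
    ring
  have hfin : (range D).Finite := by
    refine (T.finite_toSet.image fun e => D (a e + ε e * 0)).subset ?_
    rintro _ ⟨s, rfl⟩
    obtain ⟨e, he, t, ht, rfl⟩ := h.cover s
    exact ⟨e, he, (key e he t ht).symm⟩
  have hconst : D t = D s := by
    exact isPreconnected_univ.constant_of_mapsTo (T := range D) hfin.isDiscrete hDc.continuousOn
      (fun x _ => mem_range_self x) (mem_univ _) (mem_univ _)
  simp only [hD] at hconst
  rw [← intervalIntegral.integral_interval_sub_left (hii 0 t) (hii 0 s)]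
  linear_combination hconst

theorem isSlopePair (h : G.IsUnrolling T γ a ε) (u : G.H1) :
    IsSlopePair (fun s => ‖u.toFun (γ s)‖)
      (fun s => ‖unroll γ (fun e t => (ε e : ℂ) * u.weakDeriv e t) s‖) := by
  have h1 : MemLp (fun s => u.toFun (γ s)) 2 := by
    refine memLp_two_of_edges h.sign h.volume_eq fun e he => ?_
    refine (memLp_congr_ae ?_).1 (u.isH1On e).memLp
    rw [EventuallyEq, ae_restrict_iff' (G.isClosed_interval e).measurableSet]
    exact ae_of_all _ fun t ht => by rw [h.map_eq e he t ht]
  have h2 : MemLp (unroll γ fun e t => (ε e : ℂ) * u.weakDeriv e t) 2 := by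
    refine memLp_two_of_edges h.sign h.volume_eq fun e he => ?_
    refine (memLp_congr_ae ?_).1 ((u.isH1On e).memLp_deriv.const_mul (ε e : ℂ))
    rw [G.restrict_interval, EventuallyEq,
      ae_restrict_iff' (G.isOpen_openInterval e).measurableSet]
    exact ae_of_all _ fun t ht => by rw [h.unroll_apply _ he ht]
  refine ⟨fun _ => norm_nonneg _, fun _ => norm_nonneg _, h1.norm, h2.norm, fun s t hst => ?_⟩
  refine (abs_norm_sub_norm_le _ _).trans ?_
  rw [h.sub_eq_integral u (h2.locallyIntegrable (by norm_num))]
  exact intervalIntegral.norm_integral_le_integral_norm hst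

theorem norm_unroll_apply (h : G.IsUnrolling T γ a ε) (u : G.H1) {e : E} (he : e ∈ T) {t : ℝ}
    (ht : t ∈ G.openInterval e) :
    ‖unroll γ (fun e t => (ε e : ℂ) * u.weakDeriv e t) (a e + ε e * t)‖ = ‖u.weakDeriv e t‖ := by
  rw [h.unroll_apply _ he ht, norm_mul, Complex.norm_real]
  rcases h.sign e with h1 | h1 <;> simp [h1]

theorem comp_add_right (h : G.IsUnrolling T γ a ε) (x : ℝ) :
    G.IsUnrolling T (fun s => γ (s + x)) (fun e => a e - x) ε where
  sign := h.sign
  map_eq e he t ht := by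
    rw [← h.map_eq e he t ht]; congr 1; ring
  cover s := by
    obtain ⟨e, he, t, ht, hs⟩ := h.cover (s + x)
    exact ⟨e, he, t, ht, by linarith⟩

/-- Transport of an integral along an unrolling. -/
theorem integral_eq_sum (h : G.IsUnrolling T γ a ε) (u : G.H1) {F : ℝ → ℝ → ℝ}
    (hF : Integrable fun s => F ‖u.toFun (γ s)‖
      ‖unroll γ (fun e t => (ε e : ℂ) * u.weakDeriv e t) s‖) :
    ∫ s, F ‖u.toFun (γ s)‖ ‖unroll γ (fun e t => (ε e : ℂ) * u.weakDeriv e t) s‖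
      = ∑ e ∈ T, ∫ t in G.interval e, F ‖u.toFun (G.pt e t)‖ ‖u.weakDeriv e t‖ := by
  rw [integral_eq_sum_edges h.sign h.volume_eq hF]
  refine Finset.sum_congr rfl fun e he => ?_
  rw [G.restrict_interval]
  refine setIntegral_congr_fun (G.isOpen_openInterval e).measurableSet fun t ht => ?_
  rw [h.norm_unroll_apply u he ht, h.map_eq e he t (G.openInterval_subset e ht)]

end IsUnrolling

end MetricGraph

namespace MetricGraph

open Set Filter Topology NLSGraph

/-! ### The lower bound on graphs satisfying Assumption (H), and the case of equality -/

variable {V E : Type*} [Fintype E] {G : MetricGraph V E} {p m μ : ℝ}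

/-- Each edge lies on an unrolled trail along which the norm has a maximum; the largest of these
finitely many maxima bounds the norm on the whole graph. -/
theorem H1.exists_unrolled_max (hH : G.AssumptionH) (u : G.H1) (hu : u.mass = μ) (hμ : 0 < μ) :
    ∃ T γ a ε x, G.IsUnrolling T γ a ε ∧ 0 < ‖u.toFun (γ x)‖ ∧
      ∀ e, ∀ t ∈ G.interval e, ‖u.toFun (G.pt e t)‖ ≤ ‖u.toFun (γ x)‖ := by
  choose T γ a ε heT hun using hH.exists_isUnrolling
  choose x hx using fun e => ((hun e).isSlopePair u).exists_forall_le
  have hne : Nonempty E := by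
    by_contra hemp
    rw [not_nonempty_iff] at hemp
    simp [H1.mass] at hu
    linarith
  obtain ⟨e₀, -, he₀⟩ := Finset.exists_max_image Finset.univ (fun e => ‖u.toFun (γ e (x e))‖)
    Finset.univ_nonempty
  have hle : ∀ e, ∀ t ∈ G.interval e, ‖u.toFun (G.pt e t)‖ ≤ ‖u.toFun (γ e₀ (x e₀))‖ := by
    intro e t ht
    refine le_trans ?_ (he₀ e (Finset.mem_univ e))
    rw [← (hun e).map_eq e (heT e) t ht]
    exact hx e _
  refine ⟨T e₀, γ e₀, a e₀, ε e₀, x e₀, hun e₀, lt_of_le_of_ne (norm_nonneg _) fun h0 => ?_, hle⟩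
  have : u.mass = 0 := by
    rw [H1.mass]
    refine Finset.sum_eq_zero fun e _ => ?_
    rw [setIntegral_congr_fun (g := fun _ => (0 : ℝ)) (G.isClosed_interval e).measurableSet]
    · simp
    intro t ht
    have := le_antisymm ((hle e t ht).trans h0.symm.le) (norm_nonneg _)
    simp [this]
  linarith

/-- The calibration is applied on every edge. Its cross term is nonnegative off the trail and at
least twice `solPrim` along it. The square is kept for the case of equality. -/
theorem IsUnrolling.energy_ge {T : Finset E} {γ : ℝ → G.Point} {a ε : E → ℝ}
    (h : G.IsUnrolling T γ a ε) (hp : 2 < p) (u : G.H1) (hu : u.mass = μ) (x : ℝ)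
    (hx : 0 < ‖u.toFun (γ x)‖)
    (hle : ∀ e, ∀ t ∈ G.interval e, ‖u.toFun (G.pt e t)‖ ≤ ‖u.toFun (γ x)‖) :
    solLevel p ‖u.toFun (γ x)‖ μ + 1 / 2 * ∑ e, ∫ t in G.interval e,
      (‖u.weakDeriv e t‖ - solSpeed p ‖u.toFun (γ x)‖ ‖u.toFun (G.pt e t)‖) ^ 2
      ≤ u.energy p := by
  set M := ‖u.toFun (γ x)‖ with hM
  have hnn : ∀ e, ∀ᵐ t ∂(volume.restrict (G.interval e)), 0 ≤ ‖u.toFun (G.pt e t)‖ :=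
    fun e => ae_of_all _ fun t => norm_nonneg _
  have hM' : ∀ e, ∀ᵐ t ∂(volume.restrict (G.interval e)), ‖u.toFun (G.pt e t)‖ ≤ M := fun e => by
    rw [ae_restrict_iff' (G.isClosed_interval e).measurableSet]
    exact ae_of_all _ (hle e)
  have h1 : ∀ e, 1 / 2 * (∫ t in G.interval e, ‖u.weakDeriv e t‖ ^ 2)
      - 1 / p * ∫ t in G.interval e, ‖u.toFun (G.pt e t)‖ ^ p
      = 1 / 2 * (∫ t in G.interval e,
          (‖u.weakDeriv e t‖ - solSpeed p M ‖u.toFun (G.pt e t)‖) ^ 2)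
        + (∫ t in G.interval e, solSpeed p M ‖u.toFun (G.pt e t)‖ * ‖u.weakDeriv e t‖)
        - solFreq p M / 2 * ∫ t in G.interval e, ‖u.toFun (G.pt e t)‖ ^ 2 := fun e =>
    energy_eq_calibration hp hx (u.memLp e) (u.memLp_slope e) (hnn e) (hM' e)
  have h2 : u.energy p = 1 / 2 * (∑ e, ∫ t in G.interval e,
          (‖u.weakDeriv e t‖ - solSpeed p M ‖u.toFun (G.pt e t)‖) ^ 2)
        + (∑ e, ∫ t in G.interval e, solSpeed p M ‖u.toFun (G.pt e t)‖ * ‖u.weakDeriv e t‖)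
        - solFreq p M / 2 * μ := by
    rw [← hu, H1.energy, H1.mass, Finset.mul_sum, Finset.mul_sum, ← Finset.sum_sub_distrib,
      Finset.mul_sum, Finset.mul_sum, ← Finset.sum_add_distrib, ← Finset.sum_sub_distrib]
    exact Finset.sum_congr rfl fun e _ => h1 e
  have hpair := h.isSlopePair u
  have hint := (memLp_solSpeed (p := p) (m := M) hp hx hpair.memLp
    (ae_of_all _ hpair.nonneg)).integrable_mul hpair.memLp_slope
  have h3 := hpair.two_mul_le_integral (hasDerivAt_solPrim (m := M) hp) (continuous_solSpeed hp)
    (fun s hs => solSpeed_nonneg hs) (by simp [solPrim]) hint x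
  rw [← hM, two_mul_solPrim hp hx,
    h.integral_eq_sum u (F := fun w h => solSpeed p M w * h) hint] at h3
  have h4 : ∑ e ∈ T, ∫ t in G.interval e, solSpeed p M ‖u.toFun (G.pt e t)‖ * ‖u.weakDeriv e t‖
      ≤ ∑ e, ∫ t in G.interval e, solSpeed p M ‖u.toFun (G.pt e t)‖ * ‖u.weakDeriv e t‖ :=
    Finset.sum_le_sum_of_subset_of_nonneg (Finset.subset_univ T) fun e _ _ =>
      integral_nonneg fun t => mul_nonneg (solSpeed_nonneg (norm_nonneg _)) (norm_nonneg _)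
  rw [h2, solLevel]
  linarith

theorem AssumptionH.solLevel_le_energy (hH : G.AssumptionH) (hp : 2 < p) (hp6 : p < 6)
    (hm : 0 < m) (hμ : 0 < μ) (hmμ : solMass p m = μ) (u : G.H1) (hu : u.mass = μ) :
    solLevel p m μ ≤ u.energy p := by
  obtain ⟨T, γ, a, ε, x, h, hx, hle⟩ := u.exists_unrolled_max hH hu hμ
  have h1 := h.energy_ge hp u hu x hx hle
  have h2 : solLevel p m μ ≤ solLevel p ‖u.toFun (γ x)‖ μ := by
    by_cases hne : ‖u.toFun (γ x)‖ = m
    · rw [hne]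
    · exact (solLevel_lt hp hp6 hm hx hmμ hne).le
  have h3 : 0 ≤ ∑ e, ∫ t in G.interval e,
      (‖u.weakDeriv e t‖ - solSpeed p ‖u.toFun (γ x)‖ ‖u.toFun (G.pt e t)‖) ^ 2 :=
    Finset.sum_nonneg fun e _ => integral_nonneg fun t => sq_nonneg _
  linarith

/-- If the energy of `u` is minimal, then the trail through the maximum carries the whole mass, and
`|u|` is a soliton along it. -/
theorem AssumptionH.exists_soliton_of_energy_eq (hH : G.AssumptionH) (hp : 2 < p) (hp6 : p < 6)
    (hm : 0 < m) (hμ : 0 < μ) (hmμ : solMass p m = μ) (u : G.H1) (hu : u.mass = μ)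
    (hE : u.energy p = solLevel p m μ) :
    ∃ T γ a ε, G.IsUnrolling T γ a ε ∧ (∀ t, ‖u.toFun (γ t)‖ = soliton p m t) ∧
      ∀ e ∉ T, ∫ t in G.interval e, ‖u.toFun (G.pt e t)‖ ^ 2 = 0 := by
  classical
  obtain ⟨T, γ, a, ε, x, h, hx, hle⟩ := u.exists_unrolled_max hH hu hμ
  have h1 := h.energy_ge hp u hu x hx hle
  have hnn : ∀ e, 0 ≤ ∫ t in G.interval e,
      (‖u.weakDeriv e t‖ - solSpeed p ‖u.toFun (γ x)‖ ‖u.toFun (G.pt e t)‖) ^ 2 :=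
    fun e => integral_nonneg fun t => sq_nonneg _
  have h3 := Finset.sum_nonneg fun e (_ : e ∈ Finset.univ) => hnn e
  have hxm : ‖u.toFun (γ x)‖ = m := by
    by_contra hne
    have := solLevel_lt hp hp6 hm hx hmμ hne
    linarith
  rw [hxm] at h1 h3 hnn
  -- The lower bound is attained, so nothing is lost in dropping the squares: the norm of the weak
  -- derivative equals the speed almost everywhere.
  have h4 : ∑ e, ∫ t in G.interval e,
      (‖u.weakDeriv e t‖ - solSpeed p m ‖u.toFun (G.pt e t)‖) ^ 2 = 0 := by linarith
  rw [Finset.sum_eq_zero_iff_of_nonneg fun e _ => hnn e] at h4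
  -- The unrolling is translated so that the maximum sits at time 0, like that of the soliton.
  replace h := h.comp_add_right x
  set γ' : ℝ → G.Point := fun s => γ (s + x) with hγ'
  have hγ0 : ‖u.toFun (γ' 0)‖ = m := by simp only [hγ', zero_add]; exact hxm
  have hpair := h.isSlopePair u
  have hg := memLp_solSpeed (p := p) (m := m) hp hm hpair.memLp (ae_of_all _ hpair.nonneg)
  set w : ℝ → ℝ := fun s => ‖u.toFun (γ' s)‖ with hw
  have hdiff : Integrable fun s =>
      (‖unroll γ' (fun e t => (ε e : ℂ) * u.weakDeriv e t) s‖ - solSpeed p m (w s)) ^ 2 :=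
    (hpair.memLp_slope.sub hg).integrable_sq
  have h5 := h.integral_eq_sum u (F := fun w h => (h - solSpeed p m w) ^ 2) hdiff
  rw [Finset.sum_eq_zero fun e _ => h4 e (Finset.mem_univ e),
    integral_eq_zero_iff_of_nonneg (fun s => sq_nonneg _) hdiff] at h5
  have hspeed : ∀ s t, s ≤ t → |w t - w s| ≤ ∫ y in s..t, solSpeed p m (w y) := by
    intro s t hst
    refine (hpair.abs_sub_le s t hst).trans (le_of_eq ?_)
    refine intervalIntegral.integral_congr_ae ?_
    filter_upwards [h5] with y hy _
    simpa [sub_eq_zero] using hy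
  have hge := soliton_le_of_speed hp hm hpair.continuous hγ0 hspeed
  have hmass : ∫ s, w s ^ 2 = ∑ e ∈ T, ∫ t in G.interval e, ‖u.toFun (G.pt e t)‖ ^ 2 :=
    h.integral_eq_sum u (F := fun w _ => w ^ 2) hpair.integrable_sq
  have hsq : ∀ s, soliton p m s ^ 2 ≤ w s ^ 2 := fun s =>
    pow_le_pow_left₀ (soliton_pos hm s).le (hge s) 2
  have hmass2 : μ ≤ ∫ s, w s ^ 2 := by
    rw [← hmμ, solMass]
    exact integral_mono (integrable_soliton_sq hp hm) hpair.integrable_sq hsq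
  have hsplit : u.mass = (∑ e ∈ T, ∫ t in G.interval e, ‖u.toFun (G.pt e t)‖ ^ 2)
      + ∑ e ∈ Finset.univ.filter (· ∉ T), ∫ t in G.interval e, ‖u.toFun (G.pt e t)‖ ^ 2 := by
    rw [H1.mass, ← Finset.sum_filter_add_sum_filter_not Finset.univ (· ∈ T)]
    congr 2
    ext e; simp
  have hnn2 : ∀ e ∈ Finset.univ.filter (· ∉ T),
      0 ≤ ∫ t in G.interval e, ‖u.toFun (G.pt e t)‖ ^ 2 := fun e _ =>
    integral_nonneg fun t => sq_nonneg _
  have hrest := Finset.sum_nonneg hnn2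
  -- The trail already carries mass at least `μ`, which is all of it.
  have hzero : ∑ e ∈ Finset.univ.filter (· ∉ T),
      ∫ t in G.interval e, ‖u.toFun (G.pt e t)‖ ^ 2 = 0 := by linarith
  rw [Finset.sum_eq_zero_iff_of_nonneg hnn2] at hzero
  refine ⟨T, γ', _, ε, h, ?_, fun e he => hzero e (by simp [he])⟩
  have hint : Integrable fun s => w s ^ 2 - soliton p m s ^ 2 :=
    hpair.integrable_sq.sub (integrable_soliton_sq hp hm)
  have h6 : ∫ s, (w s ^ 2 - soliton p m s ^ 2) = 0 := by
    rw [integral_sub hpair.integrable_sq (integrable_soliton_sq hp hm)]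
    have : ∫ s, soliton p m s ^ 2 = μ := hmμ
    linarith
  rw [integral_eq_zero_iff_of_nonneg (fun s => sub_nonneg.2 (hsq s)) hint] at h6
  have hcont : Continuous fun s => w s ^ 2 - soliton p m s ^ 2 :=
    (hpair.continuous.pow 2).sub ((continuous_soliton hp).pow 2)
  have h7 := hcont.ae_eq_iff_eq (μ := volume) continuous_const |>.1 h6
  intro t
  have h8 := congrFun h7 t
  exact (pow_left_inj₀ (norm_nonneg _) (soliton_pos hm t).le two_ne_zero).1 (sub_eq_zero.1 h8)

end MetricGraph

namespace MetricGraph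

open Set Filter Topology NLSGraph

/-! ### Ground states and folded lines -/

variable {V E : Type*} {G : MetricGraph V E} {p m μ : ℝ}

theorem _root_.IsH1On.congr {u u' g : ℝ → ℂ} {I : Set ℝ} (hI : MeasurableSet I)
    (h : IsH1On u g I) (heq : EqOn u' u I) : IsH1On u' g I where
  continuousOn := h.continuousOn.congr heq
  memLp := (memLp_congr_ae (by
    rw [EventuallyEq, ae_restrict_iff' hI]
    exact ae_of_all _ fun t ht => (heq ht).symm)).1 h.memLp
  memLp_deriv := h.memLp_deriv
  hasWeakDerivOn φ hφ hφc hφs := by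
    rw [← h.hasWeakDerivOn φ hφ hφc hφs]
    refine setIntegral_congr_fun isOpen_interior.measurableSet fun t ht => ?_
    simp only [heq (interior_subset ht)]

theorem exists_pos_mem_interval (e : E) : ∃ t, 0 < t ∧ t ∈ G.interval e := by
  obtain ⟨q, hq0, hq⟩ := ENNReal.lt_iff_exists_nnreal_btwn.1 (G.len_pos e)
  exact ⟨q, by simpa using hq0, q.2, by simpa using hq.le⟩

theorem H1.eq_zero_of_integral_eq_zero (u : G.H1) {e : E}
    (h : ∫ t in G.interval e, ‖u.toFun (G.pt e t)‖ ^ 2 = 0) {t : ℝ} (ht : t ∈ G.interval e) :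
    u.toFun (G.pt e t) = 0 := by
  obtain ⟨b, hb0, hb, htb⟩ : ∃ b, 0 < b ∧ b ∈ G.interval e ∧ t ≤ b := by
    rcases ht.1.eq_or_lt with h0 | h0
    · obtain ⟨b, hb0, hb⟩ := exists_pos_mem_interval (G := G) e
      exact ⟨b, hb0, hb, h0 ▸ hb0.le⟩
    · exact ⟨t, h0, ht, le_rfl⟩
  have hsub : Icc 0 b ⊆ G.interval e := G.Icc_subset_interval (G.zero_mem_interval e) hb
  rw [integral_eq_zero_iff_of_nonneg (fun t => sq_nonneg _) (u.memLp e).integrable_sq] at h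
  have h2 : (fun t => u.toFun (G.pt e t)) =ᵐ[volume.restrict (Icc 0 b)] fun _ => 0 := by
    refine ae_restrict_of_ae_restrict_of_subset hsub ?_
    filter_upwards [h] with s hs
    simpa using hs
  exact Measure.eqOn_Icc_of_ae_eq volume hb0.ne h2 ((u.isH1On e).continuousOn.mono hsub)
    continuousOn_const ⟨ht.1, htb⟩

/-- On a connected graph, a function without zeros on an unrolled trail and vanishing on the other
edges forces the trail to contain all edges. -/
theorem IsUnrolling.forall_mem {T : Finset E} {γ : ℝ → G.Point} {a ε : E → ℝ}
    (h : G.IsUnrolling T γ a ε) (hconn : G.Connected) {f : G.Point → ℂ} (hpos : ∀ t, f (γ t) ≠ 0)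
    (hzero : ∀ e ∉ T, ∀ t ∈ G.interval e, f (G.pt e t) = 0) (e : E) : e ∈ T := by
  have hlen : ∀ e, ¬ G.IsHalfline e → (G.len e).toReal ∈ G.interval e := fun e he =>
    (G.mem_interval_iff he).2 ⟨ENNReal.toReal_nonneg, le_rfl⟩
  have hT : ∀ e ∈ T, ∀ t ∈ G.interval e, f (G.pt e t) ≠ 0 := fun e he t ht => by
    rw [← h.map_eq e he t ht]; exact hpos _
  -- The value of `f` at a vertex is shared by all incident edges, so it decides for all of them at
  -- once whether they belong to `T`; membership then spreads by connectedness.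
  have hvert : ∀ (v : V) (hv : v ∉ G.atInf) (e : E), (G.tail e = v ∨ G.head e = v) →
      (e ∈ T ↔ f (Sum.inl ⟨v, hv⟩) ≠ 0) := by
    rintro v hv e (rfl | rfl)
    · rw [← G.pt_zero e]
      refine ⟨fun he => hT e he 0 (G.zero_mem_interval e), fun hne => ?_⟩
      by_contra he
      exact hne (hzero e he 0 (G.zero_mem_interval e))
    · have hh : ¬ G.IsHalfline e := fun hh => hv ((G.head_mem_atInf_iff e).2 hh)
      rw [← G.pt_len hh]
      refine ⟨fun he => hT e he _ (hlen e hh), fun hne => ?_⟩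
      by_contra he
      exact hne (hzero e he _ (hlen e hh))
  have hA : ∀ e e' v, (G.tail e = v ∨ G.head e = v) → (G.tail e' = v ∨ G.head e' = v) →
      e ∈ T → e' ∈ T := by
    intro e e' v he he' hmem
    by_cases hv : v ∈ G.atInf
    · have h1 : G.head e = v := he.resolve_left fun h => G.tail_notMem_atInf e (h ▸ hv)
      have h2 : G.head e' = v := he'.resolve_left fun h => G.tail_notMem_atInf e' (h ▸ hv)
      rwa [← (G.existsUnique_edge_atInf v hv).unique h1 h2]
    · exact (hvert v hv e' he').2 ((hvert v hv e he).1 hmem)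
  obtain ⟨e₀, he₀, -⟩ := h.cover 0
  have hreach : ∀ v, Relation.ReflTransGen
      (fun a b => ∃ d : E × Bool, G.source d = a ∧ G.target d = b) (G.tail e₀) v →
      ∃ e ∈ T, G.tail e = v ∨ G.head e = v := by
    intro v hv
    induction hv with
    | refl => exact ⟨e₀, he₀, Or.inl rfl⟩
    | tail _ hstep ih =>
      obtain ⟨e, he, hev⟩ := ih
      obtain ⟨⟨e', b⟩, hs, ht⟩ := hstep
      refine ⟨e', hA e e' _ hev ?_ he, ?_⟩
      · cases b
        · exact Or.inr hs
        · exact Or.inl hs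
      · cases b
        · exact Or.inl ht
        · exact Or.inr ht
  obtain ⟨e', he', hv⟩ := hreach (G.tail e) (hconn.2 _ _)
  exact hA e' e _ hv (Or.inl rfl) he'

theorem Connected.exists_edge (hconn : G.Connected) (e₀ : E) (v : V) :
    ∃ e, G.tail e = v ∨ G.head e = v := by
  rcases (hconn.2 v (G.tail e₀)).cases_head with h | ⟨w, ⟨⟨e, b⟩, hs, -⟩, -⟩
  · exact ⟨e₀, Or.inl h.symm⟩
  · cases b
    · exact ⟨e, Or.inr hs⟩
    · exact ⟨e, Or.inl hs⟩

/-- A connected graph unrolled on the line along which some function determines the distance to the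
origin is a line or a
tower of bubbles. -/
theorem IsUnrolling.isLine_or_isBubbleTower {T : Finset E} {γ : ℝ → G.Point} {a ε : E → ℝ}
    (h : G.IsUnrolling T γ a ε) (hconn : G.Connected) (hT : ∀ e, e ∈ T) {f : G.Point → ℝ}
    (hf : ∀ s t, f (γ s) = f (γ t) → |s| = |t|) : G.IsLine ∨ G.IsBubbleTower := by
  obtain ⟨e₀, he₀, -⟩ := h.cover 0
  have hsurj : Function.Surjective γ := by
    rintro (v | ⟨e, t⟩)
    · obtain ⟨e, he⟩ := hconn.exists_edge e₀ v.1
      rcases he with he | he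
      · refine ⟨a e + ε e * 0, ?_⟩
        rw [h.map_eq e (hT e) 0 (G.zero_mem_interval e), G.pt_zero]
        exact congrArg Sum.inl (Subtype.ext he)
      · have hh : ¬ G.IsHalfline e := fun hh => v.2 (he ▸ (G.head_mem_atInf_iff e).2 hh)
        refine ⟨a e + ε e * (G.len e).toReal, ?_⟩
        rw [h.map_eq e (hT e) _ ((G.mem_interval_iff hh).2 ⟨ENNReal.toReal_nonneg, le_rfl⟩),
          G.pt_len hh]
        exact congrArg Sum.inl (Subtype.ext he)
    · refine ⟨a e + ε e * t, ?_⟩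
      rw [h.map_eq e (hT e) t (G.openInterval_subset e t.2), G.pt_of_mem t.2]
  -- At an interior point of an edge the coordinate determines the time, so `s` and `-s` can be
  -- identified only at one of the finitely many vertex times.
  have hfin : {s : ℝ | 0 < s ∧ γ s = γ (-s)}.Finite := by
    refine h.finite_vertexTimes.subset ?_
    rintro s ⟨hs, heq⟩ ⟨e, he, t, ht, hst⟩
    obtain ⟨e', he', t', ht', hst'⟩ := h.cover (-s)
    rw [hst, h.map_eq e he t (G.openInterval_subset e ht), ← hst, hst', h.map_eq e' he' t' ht']
      at heq
    obtain ⟨rfl, rfl⟩ := G.pt_injective ht heq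
    linarith
  have hmem : ∀ s, s ∈ hfin.toFinset ↔ 0 < s ∧ γ s = γ (-s) := fun s => by simp
  have hfold : G.IsFoldedLine hfin.toFinset := by
    refine ⟨γ, hsurj, fun s t => ⟨fun hst => ?_, ?_⟩, fun e =>
      ⟨a e, ε e, h.sign e, fun t ht => h.map_eq e (hT e) t ht⟩⟩
    · rcases abs_eq_abs.1 (hf s t (by rw [hst])) with h1 | h1
      · exact Or.inl h1
      · by_cases h0 : s = 0
        · left; linarith
        refine Or.inr ⟨h1, (hmem _).2 ⟨abs_pos.2 h0, ?_⟩⟩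
        have h2 : t = -s := by linarith
        rw [h2] at hst
        rcases abs_choice s with h3 | h3 <;> rw [h3]
        · exact hst
        · rw [neg_neg, hst]
    · rintro (rfl | ⟨rfl, h1⟩)
      · rfl
      · have h2 := ((hmem _).1 h1).2
        rw [abs_neg] at h2
        rcases abs_choice t with h3 | h3 <;> rw [h3] at h2
        · exact h2.symm
        · rw [neg_neg] at h2; exact h2
  by_cases hne : hfin.toFinset.Nonempty
  · exact Or.inr ⟨_, hne, fun x hx => ((hmem x).1 hx).1, hfold⟩
  · left
    rw [Finset.not_nonempty_iff_eq_empty] at hne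
    rwa [hne] at hfold

/-! ### Necessity of the folded line, and its ground state. -/

section Fintype

variable [Fintype E]

theorem AssumptionH.isLine_or_isBubbleTower (hH : G.AssumptionH) (hconn : G.Connected) (hp : 2 < p)
    (hp6 : p < 6) (hm : 0 < m) (hμ : 0 < μ) (hmμ : solMass p m = μ) (u : G.H1) (hu : u.mass = μ)
    (hE : u.energy p = solLevel p m μ) : G.IsLine ∨ G.IsBubbleTower := by
  obtain ⟨T, γ, a, ε, h, hsol, hzero⟩ :=
    hH.exists_soliton_of_energy_eq hp hp6 hm hμ hmμ u hu hE
  refine h.isLine_or_isBubbleTower hconn (h.forall_mem hconn (f := u.toFun) (fun t h0 => ?_)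
    fun e he t ht => u.eq_zero_of_integral_eq_zero (hzero e he) ht) (f := fun x => ‖u.toFun x‖)
    fun s t hst => ?_
  · have := hsol t
    rw [h0, norm_zero] at this
    exact (soliton_pos (p := p) hm t).ne this
  · simp only [hsol] at hst
    exact (soliton_eq_iff hp hm).1 hst

/-- The soliton on a folded line. -/
theorem IsFoldedLine.exists_energy_eq [Finite V] {S : Finset ℝ} (hG : G.IsFoldedLine S) (hp : 2 < p)
    (hm : 0 < m) (hmμ : solMass p m = μ) :
    ∃ u : G.H1, u.mass = μ ∧ u.energy p = solLevel p m μ := by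
  obtain ⟨γ, hsurj, hγ, hpar⟩ := hG
  choose a ε hε hmap using hpar
  have habs : ∀ s t, γ s = γ t → |s| = |t| := by
    intro s t hst
    rcases (hγ s t).1 hst with rfl | ⟨rfl, -⟩
    · rfl
    · rw [abs_neg]
  -- The choice of preimage is immaterial: two preimages differ at most by a sign and the soliton is
  -- even.
  set g : G.Point → ℝ := Function.surjInv hsurj with hg
  have hsol : ∀ s, soliton p m (g (γ s)) = soliton p m s := fun s =>
    (soliton_eq_iff hp hm).2 (habs _ _ (Function.surjInv_eq hsurj (γ s)))
  have hpt : ∀ e, ∀ t ∈ G.interval e, soliton p m (g (G.pt e t)) = soliton p m (a e + ε e * t) :=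
    fun e t ht => by rw [← hmap e t ht, hsol]
  have hvol : (volume : Measure ℝ) = Measure.sum fun e : (Finset.univ : Finset E) =>
      (volume.restrict (G.interval e)).map fun t => a e + ε e * t := by
    refine volume_eq_sum_map hε (fun e _ e' _ t ht t' ht' heq => ?_) ?_
    · refine (G.pt_injective ht (e' := e') (t' := t') ?_).1
      rw [← hmap e t (G.openInterval_subset e ht), heq, hmap e' t' (G.openInterval_subset e' ht')]
    -- The exceptional times are finitely many: each vertex has at most two preimages, and an
    -- interior point with a second preimage requires `|s| ∈ S`.
    · have hcount : (⋃ v : {v : V // v ∉ G.atInf}, {s | γ s = Sum.inl v}).Finite := by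
        refine Set.finite_iUnion fun v => ?_
        by_cases hne : ∃ s₀, γ s₀ = Sum.inl v
        · obtain ⟨s₀, hs₀⟩ := hne
          refine (Set.toFinite {s₀, -s₀}).subset fun s hs => ?_
          exact abs_eq_abs.1 (habs s s₀ ((show γ s = _ from hs).trans hs₀.symm))
        · convert Set.finite_empty
          exact eq_empty_of_forall_notMem fun s hs => hne ⟨s, hs⟩
      have hfold : {s : ℝ | |s| ∈ S}.Finite := by
        refine (S.finite_toSet.union (S.finite_toSet.image Neg.neg)).subset fun s hs => ?_
        rcases abs_choice s with h | h
        · exact Or.inl (h ▸ hs)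
        · exact Or.inr ⟨|s|, hs, by rw [h, neg_neg]⟩
      rw [ae_iff]
      refine measure_mono_null (fun s hs => ?_) ((hcount.union hfold).measure_zero volume)
      rcases hx : γ s with v | ⟨e, t⟩
      · exact Or.inl (mem_iUnion.2 ⟨v, hx⟩)
      · have h1 : γ s = γ (a e + ε e * t) := by
          rw [hmap e t (G.openInterval_subset e t.2), G.pt_of_mem t.2, hx]
        rcases (hγ _ _).1 h1 with h2 | ⟨-, h2⟩
        · exact absurd ⟨e, Finset.mem_univ e, t, t.2, h2⟩ hs
        · exact Or.inr h2
  have hH1 : ∀ e, IsH1On (fun t => (soliton p m (g (G.pt e t)) : ℂ))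
      (fun t => ((ε e * solDeriv p m (a e + ε e * t) : ℝ) : ℂ)) (G.interval e) := by
    intro e
    have hmp := measurePreserving_add_mul (hε e) (a e)
    refine IsH1On.congr (G.isClosed_interval e).measurableSet ?_
      (u := fun t => ((soliton p m (a e + ε e * t) : ℝ) : ℂ)) fun t ht => by simp only [hpt e t ht]
    have hemb := measurableEmbedding_add_mul (hε e) (a e)
    refine isH1On_ofReal countable_empty ((continuous_soliton hp).comp (by fun_prop))
      (continuous_const.mul ((continuous_solDeriv hp).comp (by fun_prop))).locallyIntegrable
      (fun t _ => ?_) ?_ ?_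
    · have h1 : HasDerivAt (fun t => a e + ε e * t) (ε e) t := by
        simpa using ((hasDerivAt_id t).const_mul (ε e)).const_add (a e)
      rw [mul_comm]
      exact (hasDerivAt_soliton (m := m) hp _).comp t h1
    · exact ((hmp.integrable_comp_emb hemb).2 (integrable_soliton_sq hp hm)).integrableOn
    · have hsq : ε e ^ 2 = 1 := by rw [sq, mul_self_eq_one_of_sign (hε e)]
      simp only [mul_pow, hsq, one_mul]
      exact ((hmp.integrable_comp_emb hemb).2 (integrable_solDeriv_sq hp hm)).integrableOn
  have hsum := fun {F : ℝ → ℝ} (hF : Integrable F) => integral_eq_sum_edges hε hvol hF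
  refine ⟨⟨fun x => (soliton p m (g x) : ℂ), _, hH1⟩, ?_, ?_⟩
  · rw [← hmμ, solMass, hsum (integrable_soliton_sq hp hm), H1.mass]
    refine Finset.sum_congr rfl fun e _ => setIntegral_congr_fun
      (G.isClosed_interval e).measurableSet fun t ht => ?_
    simp only [Complex.norm_real, Real.norm_eq_abs, sq_abs, hpt e t ht]
  · rw [← hmμ, ← soliton_energy hp hm, hsum (integrable_soliton_rpow hp hm),
      hsum (integrable_solDeriv_sq hp hm), H1.energy]
    congr 2
    · refine Finset.sum_congr rfl fun e _ => setIntegral_congr_fun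
        (G.isClosed_interval e).measurableSet fun t _ => ?_
      simp only [Complex.norm_real, Real.norm_eq_abs, sq_abs, mul_pow]
      rw [sq (ε e), mul_self_eq_one_of_sign (hε e), one_mul]
    · refine Finset.sum_congr rfl fun e _ => setIntegral_congr_fun
        (G.isClosed_interval e).measurableSet fun t ht => ?_
      simp only [Complex.norm_real, Real.norm_eq_abs, hpt e t ht, abs_of_pos (soliton_pos hm _)]

end Fintype

end MetricGraph

namespace NLSGraph

open Set Filter Topology

/-! ### Compactly supported approximations of the soliton -/

/-- The soliton truncated to `(-n, n)`. -/
noncomputable def truncSoliton (p m n t : ℝ) : ℝ := max (soliton p m t - soliton p m n) 0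

/-- The derivative of the truncated soliton. -/
noncomputable def truncSolDeriv (p m n : ℝ) : ℝ → ℝ := (Ioo (-n) n).indicator (solDeriv p m)

section trunc

variable {p m : ℝ} (hp : 2 < p) (hm : 0 < m)

include hp in
theorem continuous_truncSoliton (n : ℝ) : Continuous (truncSoliton p m n) :=
  ((continuous_soliton hp).sub continuous_const).max continuous_const

theorem truncSoliton_nonneg (n t : ℝ) : 0 ≤ truncSoliton p m n t := le_max_right _ _

include hm in
theorem truncSoliton_le (n t : ℝ) : truncSoliton p m n t ≤ soliton p m t :=
  max_le (by linarith [soliton_pos (p := p) hm n]) (soliton_pos hm t).le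

include hp hm in
theorem soliton_le_soliton_iff (s t : ℝ) : soliton p m s ≤ soliton p m t ↔ |t| ≤ |s| := by
  rw [← soliton_abs s, ← soliton_abs t]
  exact (soliton_strictAntiOn hp hm).le_iff_ge (abs_nonneg s) (abs_nonneg t)

include hp hm in
theorem truncSoliton_eq_zero {n t : ℝ} (hn : 0 ≤ n) (ht : n ≤ |t|) : truncSoliton p m n t = 0 := by
  refine max_eq_right (sub_nonpos.2 ((soliton_le_soliton_iff hp hm _ _).2 ?_))
  rwa [abs_of_nonneg hn]

include hp hm in
theorem truncSoliton_eq {n t : ℝ} (hn : 0 ≤ n) (ht : |t| ≤ n) :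
    truncSoliton p m n t = soliton p m t - soliton p m n := by
  refine max_eq_left (sub_nonneg.2 ((soliton_le_soliton_iff hp hm _ _).2 ?_))
  rwa [abs_of_nonneg hn]

include hp hm in
theorem hasDerivAt_truncSoliton {n t : ℝ} (hn : 0 ≤ n) (ht : t ∉ ({-n, n} : Set ℝ)) :
    HasDerivAt (truncSoliton p m n) (truncSolDeriv p m n t) t := by
  have hne : |t| ≠ n := fun h => ht (by
    rcases abs_choice t with h1 | h1
    · exact Or.inr (h1 ▸ h)
    · exact Or.inl (by linarith))
  rcases lt_or_gt_of_ne hne with h | h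
  · have hmem : t ∈ Ioo (-n) n := abs_lt.1 h
    rw [truncSolDeriv, indicator_of_mem hmem]
    refine ((hasDerivAt_soliton hp t).sub_const (soliton p m n)).congr_of_eventuallyEq ?_
    filter_upwards [isOpen_Ioo.mem_nhds hmem] with s hs
    exact truncSoliton_eq hp hm hn (abs_lt.2 hs).le
  · have hmem : t ∉ Ioo (-n) n := fun h' => (abs_lt.2 h').not_gt h
    rw [truncSolDeriv, indicator_of_notMem hmem]
    refine (hasDerivAt_const t (0 : ℝ)).congr_of_eventuallyEq ?_
    filter_upwards [(isOpen_lt continuous_const continuous_abs).mem_nhds h] with s hs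
    exact truncSoliton_eq_zero hp hm hn (le_of_lt hs)

include hp hm in
theorem tendsto_truncSoliton (t : ℝ) :
    Tendsto (fun n : ℕ => truncSoliton p m n t) atTop (𝓝 (soliton p m t)) := by
  have h1 := (tendsto_soliton_atTop hp hm).comp (tendsto_natCast_atTop_atTop (R := ℝ))
  have h2 := ((tendsto_const_nhds (x := soliton p m t)).sub h1).max
    (tendsto_const_nhds (x := (0 : ℝ)))
  rwa [sub_zero, max_eq_left (soliton_pos hm t).le] at h2

include hp hm in
theorem integrable_truncSoliton_sq (n : ℝ) : Integrable fun t => truncSoliton p m n t ^ 2 :=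
  (integrable_soliton_sq hp hm).mono' ((continuous_truncSoliton hp n).pow 2).aestronglyMeasurable
    (ae_of_all _ fun t => by
      rw [Real.norm_of_nonneg (sq_nonneg _)]
      exact pow_le_pow_left₀ (truncSoliton_nonneg n t) (truncSoliton_le hm n t) 2)

include hp in
theorem measurable_truncSolDeriv (n : ℝ) : Measurable (truncSolDeriv p m n) :=
  (continuous_solDeriv hp).measurable.indicator measurableSet_Ioo

theorem truncSolDeriv_sq_le (n t : ℝ) : ‖truncSolDeriv p m n t ^ 2‖ ≤ solDeriv p m t ^ 2 := by
  rw [Real.norm_of_nonneg (sq_nonneg _), truncSolDeriv]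
  by_cases h : t ∈ Ioo (-n) n
  · rw [indicator_of_mem h]
  · rw [indicator_of_notMem h]; simp [sq_nonneg]

include hp hm in
theorem integrable_truncSolDeriv_sq (n : ℝ) : Integrable fun t => truncSolDeriv p m n t ^ 2 :=
  (integrable_solDeriv_sq hp hm).mono' ((measurable_truncSolDeriv hp n).pow_const 2).aestronglyMeasurable
    (ae_of_all _ (truncSolDeriv_sq_le n))

include hp hm in
theorem tendsto_integral_truncSoliton_sq :
    Tendsto (fun n : ℕ => ∫ t, truncSoliton p m n t ^ 2) atTop (𝓝 (solMass p m)) :=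
  tendsto_integral_of_dominated_convergence _
    (fun n => ((continuous_truncSoliton hp n).pow 2).aestronglyMeasurable)
    (integrable_soliton_sq hp hm) (fun n => ae_of_all _ fun t => by
      rw [Real.norm_of_nonneg (sq_nonneg _)]
      exact pow_le_pow_left₀ (truncSoliton_nonneg n t) (truncSoliton_le hm n t) 2)
    (ae_of_all _ fun t => (tendsto_truncSoliton hp hm t).pow 2)

include hp hm in
theorem tendsto_integral_truncSoliton_rpow :
    Tendsto (fun n : ℕ => ∫ t, truncSoliton p m n t ^ p) atTop (𝓝 (∫ t, soliton p m t ^ p)) :=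
  tendsto_integral_of_dominated_convergence _
    (fun n => ((continuous_truncSoliton hp n).rpow_const
      fun _ => Or.inr (by linarith)).aestronglyMeasurable)
    (integrable_soliton_rpow hp hm) (fun n => ae_of_all _ fun t => by
      rw [Real.norm_of_nonneg (Real.rpow_nonneg (truncSoliton_nonneg _ _) _)]
      exact Real.rpow_le_rpow (truncSoliton_nonneg n t) (truncSoliton_le hm n t) (by linarith))
    (ae_of_all _ fun t => (tendsto_truncSoliton hp hm t).rpow_const (Or.inr (by linarith)))

include hp hm in
theorem tendsto_integral_truncSolDeriv_sq :
    Tendsto (fun n : ℕ => ∫ t, truncSolDeriv p m n t ^ 2) atTop (𝓝 (∫ t, solDeriv p m t ^ 2)) := by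
  refine tendsto_integral_of_dominated_convergence _
    (fun n => ((measurable_truncSolDeriv hp n).pow_const 2).aestronglyMeasurable)
    (integrable_solDeriv_sq hp hm) (fun n => ae_of_all _ (truncSolDeriv_sq_le n))
    (ae_of_all _ fun t => ?_)
  refine tendsto_const_nhds.congr' ?_
  filter_upwards [(tendsto_natCast_atTop_atTop (R := ℝ)).eventually_gt_atTop |t|] with n hn
  rw [truncSolDeriv, indicator_of_mem (show t ∈ Ioo (-(n : ℝ)) n from abs_lt.1 hn)]

end trunc

end NLSGraph

/-! ### Trial functions on a halfline and the upper bound. -/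

namespace MetricGraph

open Set Filter Topology NLSGraph

variable {V E : Type*} [Fintype E] {G : MetricGraph V E} {p m μ : ℝ}

open Classical in
/-- A function on the line supported in `[0, ∞)`, placed on a halfline of the graph. -/
theorem exists_H1_of_halfline {e₀ : E} (he₀ : G.IsHalfline e₀) {f f' : ℝ → ℝ} {s : Set ℝ}
    (hs : s.Countable) (hf : Continuous f) (hf' : LocallyIntegrable f')
    (hd : ∀ t, t ∉ s → HasDerivAt f (f' t) t) (hi : Integrable fun t => f t ^ 2)
    (hi' : Integrable fun t => f' t ^ 2) (h0 : ∀ t, t ≤ 0 → f t = 0)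
    (h0' : ∀ t, t ≤ 0 → f' t = 0) (hp : 2 < p) :
    ∃ u : G.H1, u.mass = (∫ t, f t ^ 2) ∧
      u.energy p = 1 / 2 * (∫ t, f' t ^ 2) - 1 / p * ∫ t, |f t| ^ p := by
  set F : G.Point → ℂ := fun x => match x with
    | Sum.inl _ => 0
    | Sum.inr ⟨e, t⟩ => if e = e₀ then (f t : ℂ) else 0 with hF
  have hF0 : ∀ e t, e ≠ e₀ → F (G.pt e t) = 0 := by
    intro e t hne
    rcases hx : G.pt e t with v | ⟨e', t'⟩
    · rfl
    · obtain ⟨rfl, -, -⟩ := G.mem_openInterval_of_pt_eq_inr hx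
      exact if_neg hne
  have hF1 : ∀ t ∈ G.interval e₀, F (G.pt e₀ t) = f t := by
    intro t ht
    rcases ht.1.eq_or_lt with h | h
    · rw [← h, G.pt_zero, h0 0 le_rfl]; simp [hF]
    · have hm : t ∈ G.openInterval e₀ := ⟨h, by
        rw [show G.len e₀ = ⊤ from he₀]; exact ENNReal.ofReal_lt_top⟩
      rw [G.pt_of_mem hm]
      exact if_pos rfl
  have hH1 : ∀ e, IsH1On (fun t => F (G.pt e t)) (fun t => ((if e = e₀ then f' t else 0 : ℝ) : ℂ))
      (G.interval e) := by
    intro e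
    by_cases he : e = e₀
    · subst he
      simp only [if_true]
      exact IsH1On.congr (G.isClosed_interval e).measurableSet
        (isH1On_ofReal hs hf hf' hd hi.integrableOn hi'.integrableOn) hF1
    · simp only [he, if_false]
      refine IsH1On.congr (G.isClosed_interval e).measurableSet
        (isH1On_ofReal (f := fun _ => 0) countable_empty continuous_const
          (locallyIntegrable_const 0) (fun t _ => hasDerivAt_const t 0) (by simp) (by simp))
        fun t _ => ?_
      simpa using hF0 e t he
  have hsum : ∀ (A : E → ℝ), (∀ e, e ≠ e₀ → A e = 0) → ∑ e, A e = A e₀ := fun A hA =>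
    Finset.sum_eq_single e₀ (fun e _ he => hA e he) (fun h => absurd (Finset.mem_univ _) h)
  have hext : ∀ (Q : ℝ → ℝ), (∀ t, t ≤ 0 → Q t = 0) → ∫ t in G.interval e₀, Q t = ∫ t, Q t :=
    fun Q hQ => setIntegral_eq_integral_of_forall_compl_eq_zero fun t ht => hQ t (by
      by_contra h
      exact ht ((G.mem_interval_iff_of_isHalfline he₀).2 (not_le.1 h).le))
  have hp0 : p ≠ 0 := by linarith
  refine ⟨⟨F, _, hH1⟩, ?_, ?_⟩
  · rw [H1.mass, hsum _ fun e he => by simp [hF0 e _ he], ← hext _ fun t ht => by simp [h0 t ht]]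
    refine setIntegral_congr_fun (G.isClosed_interval e₀).measurableSet fun t ht => ?_
    simp only [hF1 t ht, Complex.norm_real, Real.norm_eq_abs, sq_abs]
  · rw [H1.energy, hsum _ fun e he => by simp [he],
      hsum _ fun e he => by simp [hF0 e _ he, Real.zero_rpow hp0],
      ← hext _ fun t ht => by simp [h0' t ht],
      ← hext (fun t => |f t| ^ p) fun t ht => by simp [h0 t ht, Real.zero_rpow hp0]]
    congr 2
    · refine setIntegral_congr_fun (G.isClosed_interval e₀).measurableSet fun t ht => ?_
      simp only [if_true, Complex.norm_real, Real.norm_eq_abs, sq_abs]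
    · refine setIntegral_congr_fun (G.isClosed_interval e₀).measurableSet fun t ht => ?_
      simp only [hF1 t ht, Complex.norm_real, Real.norm_eq_abs]

/-- A multiple of a truncated soliton, placed on a halfline. -/
theorem exists_H1_truncSoliton {e₀ : E} (he₀ : G.IsHalfline e₀) (hp : 2 < p) (hm : 0 < m) {n c : ℝ}
    (hn : 0 ≤ n) (hc : 0 ≤ c) :
    ∃ u : G.H1, u.mass = c ^ 2 * (∫ t, truncSoliton p m n t ^ 2) ∧
      u.energy p = 1 / 2 * (c ^ 2 * ∫ t, truncSolDeriv p m n t ^ 2)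
        - 1 / p * (c ^ p * ∫ t, truncSoliton p m n t ^ p) := by
  have hmp := measurePreserving_sub_right (volume : Measure ℝ) n
  have hemb : MeasurableEmbedding fun t : ℝ => t - n := measurableEmbedding_subRight n
  -- The shift by `n` moves the support into `[0, 2 * n]`, so the function vanishes at the vertex of
  -- the halfline.
  have hcont : Continuous fun t => c * truncSoliton p m n (t - n) :=
    continuous_const.mul ((continuous_truncSoliton hp n).comp (by fun_prop))
  have hloc : LocallyIntegrable fun t => c * truncSolDeriv p m n (t - n) := by
    have h1 : MemLp (fun t => truncSolDeriv p m n (t - n)) 2 :=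
      ((memLp_two_iff_integrable_sq (measurable_truncSolDeriv hp n).aestronglyMeasurable).2
        (integrable_truncSolDeriv_sq hp hm n)).comp_measurePreserving hmp
    exact (h1.const_mul c).locallyIntegrable (by norm_num)
  have hd : ∀ t, t ∉ ({0, 2 * n} : Set ℝ) → HasDerivAt (fun t => c * truncSoliton p m n (t - n))
      (c * truncSolDeriv p m n (t - n)) t := by
    intro t ht
    have h1 : t - n ∉ ({-n, n} : Set ℝ) := by
      rintro (h | h)
      · exact ht (Or.inl (by linarith))
      · exact ht (Or.inr (by rw [mem_singleton_iff] at h ⊢; linarith))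
    have h2 := (hasDerivAt_truncSoliton hp hm hn h1).comp t ((hasDerivAt_id t).sub_const n)
    rw [mul_one] at h2
    exact h2.const_mul c
  have hi : Integrable fun t => (c * truncSoliton p m n (t - n)) ^ 2 := by
    simp_rw [mul_pow]
    exact ((hmp.integrable_comp_emb hemb).2 (integrable_truncSoliton_sq hp hm n)).const_mul _
  have hi' : Integrable fun t => (c * truncSolDeriv p m n (t - n)) ^ 2 := by
    simp_rw [mul_pow]
    exact ((hmp.integrable_comp_emb hemb).2 (integrable_truncSolDeriv_sq hp hm n)).const_mul _
  obtain ⟨u, hu, hE⟩ := exists_H1_of_halfline he₀ (Set.toFinite _).countable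
    hcont hloc hd hi hi'
    (fun t ht => by
      rw [truncSoliton_eq_zero hp hm hn (by rw [abs_of_nonpos (by linarith)]; linarith), mul_zero])
    (fun t ht => by
      rw [truncSolDeriv, indicator_of_notMem (fun h => by linarith [h.1]), mul_zero]) hp
  refine ⟨u, ?_, ?_⟩
  · rw [hu, integral_sub_right_eq_self (fun t => (c * truncSoliton p m n t) ^ 2) n]
    simp_rw [mul_pow]
    rw [integral_const_mul]
  · rw [hE, integral_sub_right_eq_self (fun t => (c * truncSolDeriv p m n t) ^ 2) n,
      integral_sub_right_eq_self (fun t => |c * truncSoliton p m n t| ^ p) n]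
    simp_rw [abs_mul, abs_of_nonneg hc, abs_of_nonneg (truncSoliton_nonneg _ _), mul_pow,
      Real.mul_rpow hc (truncSoliton_nonneg _ _)]
    rw [integral_const_mul, integral_const_mul]

/-- A halfline has room for arbitrarily wide truncated solitons, so the energy of the soliton is
approached at mass `μ` whatever the rest of the graph. The lower bound is where Assumption (H)
enters. -/
theorem AssumptionH.isGLB_energyLevels (hH : G.AssumptionH) (hnc : G.Noncompact) (hp : 2 < p)
    (hp6 : p < 6) (hm : 0 < m) (hμ : 0 < μ) (hmμ : solMass p m = μ) :
    IsGLB (G.energyLevels p μ) (solLevel p m μ) := by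
  constructor
  · rintro c ⟨u, hu, rfl⟩
    exact hH.solLevel_le_energy hp hp6 hm hμ hmμ u hu
  intro b hb
  obtain ⟨v, hv⟩ := hnc
  obtain ⟨e₀, he₀, -⟩ := G.existsUnique_edge_atInf v hv
  have he₀' : G.IsHalfline e₀ := (G.head_mem_atInf_iff e₀).1 (he₀ ▸ hv)
  have hM := tendsto_integral_truncSoliton_sq hp hm
  rw [hmμ] at hM
  -- This factor restores the mass `μ` lost by truncation. It tends to 1, so the limit of the
  -- energies is unchanged.
  have hc : Tendsto (fun n : ℕ => √(μ / ∫ t, truncSoliton p m n t ^ 2)) atTop (𝓝 1) := by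
    have := ((tendsto_const_nhds (x := μ)).div hM hμ.ne').sqrt
    rwa [div_self hμ.ne', Real.sqrt_one] at this
  have hlim := (((hc.pow 2).mul (tendsto_integral_truncSolDeriv_sq hp hm)).const_mul (1 / 2)).sub
    (((hc.rpow_const (p := p) (Or.inl one_ne_zero)).mul
      (tendsto_integral_truncSoliton_rpow hp hm)).const_mul (1 / p))
  rw [one_pow, one_mul, Real.one_rpow, one_mul, soliton_energy hp hm, hmμ] at hlim
  refine ge_of_tendsto hlim ?_
  -- The truncation at `n = 0` is zero and cannot be normalized, hence the restriction to large `n`.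
  filter_upwards [hM.eventually_const_lt hμ] with n hn
  obtain ⟨u, hu, hE⟩ := exists_H1_truncSoliton (p := p) (m := m) (n := n) he₀' hp hm
    (Nat.cast_nonneg n) (Real.sqrt_nonneg (μ / ∫ t, truncSoliton p m n t ^ 2))
  rw [← hE]
  refine hb ⟨u, ?_, rfl⟩
  rw [hu, Real.sq_sqrt (div_nonneg hμ.le hn.le), div_mul_cancel₀ _ hn.ne']

end MetricGraph

theorem theorem5p1 {V E : Type*} [Fintype V] [Fintype E] (G : MetricGraph V E)
    (hconn : G.Connected) (hnc : G.Noncompact) (hH : G.AssumptionH)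
    (p μ : ℝ) (hp2 : 2 < p) (hp6 : p < 6) (hμ : 0 < μ) :
    IsGLB (G.energyLevels p μ) (G.infEnergy p μ) ∧
    IsGLB (lineEnergyLevels p μ) (lineInfEnergy p μ) ∧
    G.infEnergy p μ = lineInfEnergy p μ ∧
    ((∃ u : G.H1, G.IsGroundState p μ u) ↔ (G.IsLine ∨ G.IsBubbleTower)) := by
  obtain ⟨m, hm, hmμ⟩ := NLSGraph.exists_solMass_eq_of_pos hp2 hp6 hμ
  have hG := hH.isGLB_energyLevels hnc hp2 hp6 hm hμ hmμ
  have hL := NLSGraph.isLeast_lineEnergyLevels hp2 hp6 hm hμ hmμ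
  have hG' : G.infEnergy p μ = NLSGraph.solLevel p m μ := hG.csInf_eq hG.nonempty
  have hL' : lineInfEnergy p μ = NLSGraph.solLevel p m μ := hL.csInf_eq
  refine ⟨hG' ▸ hG, hL' ▸ hL.isGLB, hG'.trans hL'.symm, ?_⟩
  constructor
  · rintro ⟨u, hu, hE⟩
    exact hH.isLine_or_isBubbleTower hconn hp2 hp6 hm hμ hmμ u hu (hE.trans hG')
  · rintro (h | ⟨S, -, -, h⟩) <;>
    · obtain ⟨u, hu, hE⟩ := MetricGraph.IsFoldedLine.exists_energy_eq h hp2 hm hmμ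
      exact ⟨u, hu, hE.trans hG'.symm⟩
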